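/- **Theorem.** Let $X$ be a separable Banach space (over $\mathbb{R}$) which is *stable*: call a sequence $(x_n)$ in $X$ type determining if $\lim_n\|z+x_n\|$ exists for every $z\in X$; stability means that for all type determining $(x_n)$, $(y_m)$ one has $\lim_n\lim_m\|x_n+y_m\|=\lim_m\lim_n\|x_n+y_m\|$ (whenever both iterated limits exist). Let $\mathcal M(X)$ be the space of finite signed Radon measures on $X$ with the total variation norm, let $C_b(X)$ be the space of bounded continuous real functions on $X$ with the sup norm, and let $\Phi:\mathcal M(X)\to C_b(X)$ be given by $\Phi(\mu)(y)=\int_X e^{-\|x-y\|}\,\mu(dx)$. Put $A_1=C_b(X)$, and let $A_0=\Phi(\mathcal M(X))$ be normed by the gauge of the image under $\Phi$ of the unit ball of $\mathcal M(X)$. For $0<\theta<1$ and $1<p<\infty$ let $R=[A_0,A_1]_{\theta,p}$ be the Lions–Peetre interpolation space, i.e. the space of all $z\in A_1$ which can be written as $z=x_1(t)+x_2(t)$ for all $t\in\mathbb R$ with $e^{\theta t}x_1(t)\in L_p(\mathbb R;A_0)$ and $e^{-(1-\theta)t}x_2(t)\in L_p(\mathbb R;A_1)$, with the norm $$\|z\|_{\theta,p}=\inf\Big\{\|e^{\theta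 t}x_1(t)\|_{L_p(A_0)}^{1-\theta}\,\|e^{-(1-\theta)t}x_2(t)\|_{L_p(A_1)}^{\theta}\Big\},$$ the infimum being over all such representations of $z$. Then, for all $0<\theta<1$ and $1<p<\infty$, $R$ is a separable reflexive Banach space; for each $z\in X$ the translation $T_zf(x)=f(x-z)$ is a linear isometry of $R$ onto itself; and, with the group $\mathcal U$ of all linear isometries of $R$ onto itself endowed with the strong operator topology, the map $z\mapsto T_z$ is a group isomorphism ($T_{x+y}=T_x\circ T_y$, $(T_x)^{-1}=T_{-x}$) and a homeomorphism from $X$ with its norm topology onto a closed subgroup $G$ of $\mathcal U$. -/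

import Mathlib

open MeasureTheory Filter Topology Set
open scoped BoundedContinuousFunction ENNReal

universe u

noncomputable section

/-! ### Stable Banach spaces -/

/-- `x` is type determining: it realizes a type, i.e. `τ z = lim_n ‖z + x n‖` exists for every
`z`. -/
def IsTypeDetermining {X : Type*} [NormedAddCommGroup X] (x : ℕ → X) : Prop :=
  ∃ τ : X → ℝ, ∀ z, Tendsto (fun n => ‖z + x n‖) atTop (𝓝 (τ z))

/-- `lim_n lim_m a n m` exists and is equal to `l`. -/
def HasIteratedLimit (a : ℕ → ℕ → ℝ) (l : ℝ) : Prop :=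
  ∃ b : ℕ → ℝ, (∀ n, Tendsto (a n) atTop (𝓝 (b n))) ∧ Tendsto b atTop (𝓝 l)

/-- Stability (Krivine–Maurey): for type determining sequences `(x n)` and `(y m)`, the two iterated
limits of `‖x n + y m‖` are equal. (They are only compared when both exist; in general one can pass
to subsequences, which determine the same types.) -/
def IsStable (X : Type*) [NormedAddCommGroup X] : Prop :=
  ∀ x y : ℕ → X, IsTypeDetermining x → IsTypeDetermining y → ∀ l l' : ℝ,
    HasIteratedLimit (fun n m => ‖x n + y m‖) l →
    HasIteratedLimit (fun m n => ‖x n + y m‖) l' → l = l'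

/-! ### The operator `Φ : M(X) → C_b(X)` and the space `A₀ = Φ(M(X))` -/

section Phi

variable {X : Type u} [NormedAddCommGroup X] [MeasurableSpace X] [BorelSpace X]

/-- The norm of `M(X)`: the total variation `|μ|(X)`. The elements of `M(X)` are the (finite) signed
Borel measures; on a complete separable `X` each of them is a Radon measure. -/
def measureNorm {Y : Type*} [MeasurableSpace Y] (μ : SignedMeasure Y) : ℝ := μ.totalVariation.real univ

lemma measureNorm_eq {Y : Type*} [MeasurableSpace Y] (μ : SignedMeasure Y) : measureNorm μ = μ.variation.real univ := by
  rw [measureNorm, SignedMeasure.totalVariation_eq_variation]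

instance isFiniteMeasure_variation_signedMeasure {Y : Type*} [MeasurableSpace Y]
    (μ : SignedMeasure Y) :
    IsFiniteMeasure μ.variation := by
  rw [← SignedMeasure.totalVariation_eq_variation]
  infer_instance

lemma measureNorm_add_le {Y : Type*} [MeasurableSpace Y] (μ ν : SignedMeasure Y) :
    measureNorm (μ + ν) ≤ measureNorm μ + measureNorm ν := by
  simp only [measureNorm_eq]
  rw [← measureReal_add_apply]
  exact ENNReal.toReal_mono (measure_ne_top _ _) (VectorMeasure.variation_add_le univ)

lemma measureNorm_smul {Y : Type*} [MeasurableSpace Y] (c : ℝ) (μ : SignedMeasure Y) :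
    measureNorm (c • μ) = |c| * measureNorm μ := by
  simp only [measureNorm_eq]
  rw [VectorMeasure.variation_smul]
  simp [measureReal_def]

lemma norm_exp_neg_norm_le {Y : Type*} [NormedAddCommGroup Y] (x : Y) : ‖Real.exp (-‖x‖)‖ ≤ 1 := by
  rw [Real.norm_eq_abs, Real.abs_exp]
  simp

lemma continuous_exp_neg_norm {Y : Type*} [NormedAddCommGroup Y] (y : Y) :
    Continuous fun x : Y => Real.exp (-‖x - y‖) := by
  fun_prop

lemma integrable_exp_neg_norm (μ : SignedMeasure X) (y : X) :
    Integrable (fun x : X => Real.exp (-‖x - y‖)) μ.variation :=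
  Integrable.of_bound (continuous_exp_neg_norm y).aestronglyMeasurable 1
    (ae_of_all _ fun x => norm_exp_neg_norm_le (x - y))

lemma norm_integral_exp_neg_norm_le (μ : SignedMeasure X) (y : X) :
    ‖∫ᵛ x, Real.exp (-‖x - y‖) ∂•μ‖ ≤ measureNorm μ := by
  have h := VectorMeasure.norm_integral_le_of_norm_le_const (μ := μ)
    (B := ContinuousLinearMap.lsmul ℝ ℝ) (f := fun x : X => Real.exp (-‖x - y‖)) (C := 1)
    (ae_of_all _ fun x => norm_exp_neg_norm_le (x - y))
  rw [measureNorm_eq]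
  simpa using h

/-- The operator `Φ : M(X) → C_b(X)`, `Φ(μ)(y) = ∫ exp(-‖x - y‖) μ(dx)`. -/
def Phi (X : Type u) [NormedAddCommGroup X] [MeasurableSpace X] [BorelSpace X] :
    SignedMeasure X →ₗ[ℝ] (X →ᵇ ℝ) where
  toFun μ := BoundedContinuousFunction.ofNormedAddCommGroup
    (fun y => ∫ᵛ x, Real.exp (-‖x - y‖) ∂•μ)
    (VectorMeasure.continuous_of_dominated (bound := fun _ => 1)
      (fun y => (continuous_exp_neg_norm y).aestronglyMeasurable)
      (fun y => ae_of_all _ fun x => norm_exp_neg_norm_le (x - y))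
      (integrable_const 1) (ae_of_all _ fun x => by fun_prop))
    (measureNorm μ) (norm_integral_exp_neg_norm_le μ)
  map_add' μ ν := by
    ext y
    exact VectorMeasure.integral_add_vectorMeasure (integrable_exp_neg_norm μ y)
      (integrable_exp_neg_norm ν y)
  map_smul' c μ := by
    ext y
    exact VectorMeasure.integral_smul_vectorMeasure _ c

lemma Phi_apply (μ : SignedMeasure X) (y : X) :
    Phi X μ y = ∫ᵛ x, Real.exp (-‖x - y‖) ∂•μ := rfl

lemma norm_Phi_le (μ : SignedMeasure X) : ‖Phi X μ‖ ≤ measureNorm μ :=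
  BoundedContinuousFunction.norm_ofNormedAddCommGroup_le _
    ENNReal.toReal_nonneg (norm_integral_exp_neg_norm_le μ)

/-- The vector space `A₀ = Φ(M(X)) ⊆ C_b(X)`. It is a type of its own because it does not carry the
norm of `C_b(X)`. -/
def PhiRange (X : Type u) [NormedAddCommGroup X] [MeasurableSpace X] [BorelSpace X] : Type u :=
  LinearMap.range (Phi X)

instance : AddCommGroup (PhiRange X) := inferInstanceAs (AddCommGroup (LinearMap.range (Phi X)))

instance : Module ℝ (PhiRange X) := inferInstanceAs (Module ℝ (LinearMap.range (Phi X)))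

/-- The inclusion of `A₀` in `C_b(X)`, as a linear map. -/
def PhiRange.toBCF (X : Type u) [NormedAddCommGroup X] [MeasurableSpace X] [BorelSpace X] :
    PhiRange X →ₗ[ℝ] (X →ᵇ ℝ) :=
  (LinearMap.range (Phi X)).subtype

/-- The image `Φ(Ba M(X))` of the closed unit ball of `M(X)`, as a subset of `A₀`. -/
def PhiBall (X : Type u) [NormedAddCommGroup X] [MeasurableSpace X] [BorelSpace X] :
    Set (PhiRange X) :=
  {f | ∃ μ : SignedMeasure X, measureNorm μ ≤ 1 ∧ Phi X μ = PhiRange.toBCF X f}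

lemma toBCF_injective : Function.Injective (PhiRange.toBCF X) := Subtype.val_injective

lemma balanced_PhiBall : Balanced ℝ (PhiBall X) := by
  rintro c hc _ ⟨f, ⟨μ, hμ, h⟩, rfl⟩
  refine ⟨c • μ, ?_, by simp [h]⟩
  rw [measureNorm_smul]
  exact mul_le_one₀ hc ENNReal.toReal_nonneg hμ

lemma convex_PhiBall : Convex ℝ (PhiBall X) := by
  rintro f ⟨μ, hμ, h⟩ g ⟨ν, hν, h'⟩ a b ha hb hab
  refine ⟨a • μ + b • ν, ?_, by simp [h, h']⟩
  refine (measureNorm_add_le _ _).trans ?_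
  rw [measureNorm_smul, measureNorm_smul, abs_of_nonneg ha, abs_of_nonneg hb]
  nlinarith

lemma absorbent_PhiBall : Absorbent ℝ (PhiBall X) := by
  rw [absorbent_iff_eventually_nhdsNE_zero]
  intro f
  obtain ⟨μ, hμ⟩ : ∃ μ, Phi X μ = PhiRange.toBCF X f := f.2
  have hlim : Tendsto (fun c : ℝ => |c| * measureNorm μ) (𝓝 0) (𝓝 0) := by
    have : Continuous fun c : ℝ => |c| * measureNorm μ := by fun_prop
    simpa using this.tendsto 0
  filter_upwards [nhdsWithin_le_nhds (hlim.eventually (ge_mem_nhds one_pos))] with c hc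
  exact ⟨c • μ, by rwa [measureNorm_smul], by simp [hμ]⟩

lemma norm_toBCF_le_gauge (f : PhiRange X) : ‖PhiRange.toBCF X f‖ ≤ gauge (PhiBall X) f := by
  refine le_of_forall_gt_imp_ge_of_dense fun a ha => ?_
  obtain ⟨b, hb, hba, g, ⟨μ, hμ, h⟩, rfl⟩ := exists_lt_of_gauge_lt absorbent_PhiBall ha
  change ‖PhiRange.toBCF X (b • g)‖ ≤ a
  rw [map_smul, norm_smul, ← h, Real.norm_of_nonneg hb.le]
  nlinarith [norm_Phi_le μ]

/-- The norm of `A₀ = Φ(M(X))`: the gauge of `Φ(Ba M(X))`. -/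
instance : Norm (PhiRange X) := ⟨gauge (PhiBall X)⟩

lemma PhiRange.norm_def (f : PhiRange X) : ‖f‖ = gauge (PhiBall X) f := rfl

lemma PhiRange.core : NormedSpace.Core ℝ (PhiRange X) where
  norm_nonneg f := gauge_nonneg f
  norm_smul c f := gauge_smul balanced_PhiBall c f
  norm_triangle f g := gauge_add_le convex_PhiBall absorbent_PhiBall f g
  norm_eq_zero_iff f := by
    refine ⟨fun h => ?_, fun h => by rw [h, PhiRange.norm_def, gauge_zero]⟩
    have h0 := norm_toBCF_le_gauge f
    rw [← PhiRange.norm_def, h, norm_le_zero_iff] at h0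
    exact toBCF_injective (h0.trans (map_zero _).symm)

instance : NormedAddCommGroup (PhiRange X) := NormedAddCommGroup.ofCore PhiRange.core

instance : NormedSpace ℝ (PhiRange X) := NormedSpace.ofCore PhiRange.core

/-- The (continuous) inclusion of `A₀ = Φ(M(X))` in `A₁ = C_b(X)`. -/
def PhiRange.incl (X : Type u) [NormedAddCommGroup X] [MeasurableSpace X] [BorelSpace X] :
    PhiRange X →L[ℝ] (X →ᵇ ℝ) :=
  (PhiRange.toBCF X).mkContinuous 1 fun f => by
    simpa [PhiRange.norm_def] using norm_toBCF_le_gauge f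

end Phi

/-! ### Lions–Peetre interpolation spaces `[A₀, A₁]_{θ,p}`

Only the case where `A₀` is continuously embedded in `A₁` by `ι` is needed, so that `A₁` serves as
the common space and `A₀ + A₁ = A₁`. -/

section Interpolation

variable {A₀ A₁ : Type*} [NormedAddCommGroup A₀] [NormedSpace ℝ A₀]
  [NormedAddCommGroup A₁] [NormedSpace ℝ A₁]

/-- `z = x₁ t + x₂ t` for all real `t`, with `exp(θ t) x₁(t) ∈ L_p(A₀)` and
`exp(-(1 - θ) t) x₂(t) ∈ L_p(A₁)`. -/
structure IsInterpRep (ι : A₀ →L[ℝ] A₁) (θ p : ℝ) (z : A₁) (x₁ : ℝ → A₀) (x₂ : ℝ → A₁) :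
    Prop where
  eq_add : ∀ t, z = ι (x₁ t) + x₂ t
  memLp₁ : MemLp (fun t => Real.exp (θ * t) • x₁ t) (ENNReal.ofReal p) volume
  memLp₂ : MemLp (fun t => Real.exp (-(1 - θ) * t) • x₂ t) (ENNReal.ofReal p) volume

/-- The underlying set of `[A₀, A₁]_{θ,p}`. -/
def interpSet (ι : A₀ →L[ℝ] A₁) (θ p : ℝ) : Set A₁ :=
  {z | ∃ x₁ x₂, IsInterpRep ι θ p z x₁ x₂}

/-- The norm of `[A₀, A₁]_{θ,p}`: the infimum of
`‖exp(θ t) x₁(t)‖_p ^ (1 - θ) * ‖exp(-(1 - θ) t) x₂(t)‖_p ^ θ` over all representations. -/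
def interpNorm (ι : A₀ →L[ℝ] A₁) (θ p : ℝ) (z : A₁) : ℝ :=
  sInf {c | ∃ x₁ x₂, IsInterpRep ι θ p z x₁ x₂ ∧
    c = (eLpNorm (fun t => Real.exp (θ * t) • x₁ t) (ENNReal.ofReal p) volume).toReal ^ (1 - θ) *
      (eLpNorm (fun t => Real.exp (-(1 - θ) * t) • x₂ t) (ENNReal.ofReal p) volume).toReal ^ θ}

/-- The normed space `R` is the interpolation space `[A₀, A₁]_{θ,p}`, with the linear map `j` as its
inclusion in `A₁`. -/
structure IsInterpolationSpace (ι : A₀ →L[ℝ] A₁) (θ p : ℝ) {R : Type*} [NormedAddCommGroup R]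
    [NormedSpace ℝ R] (j : R →ₗ[ℝ] A₁) : Prop where
  injective : Function.Injective j
  range_eq : range j = interpSet ι θ p
  norm_eq : ∀ r, ‖r‖ = interpNorm ι θ p (j r)

end Interpolation

/-! ### Reflexivity and the isometry group -/

/-- A Banach space is reflexive if its canonical map to its bidual is onto. -/
def IsReflexiveSpace (R : Type*) [NormedAddCommGroup R] [NormedSpace ℝ R] : Prop :=
  Function.Surjective (NormedSpace.inclusionInDoubleDual ℝ R)

/-- The strong operator topology (pointwise convergence in norm) on the group of all linear
isometries of `R` onto itself. -/
instance strongOperatorTopology (R : Type*) [NormedAddCommGroup R] [NormedSpace ℝ R] :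
    TopologicalSpace (R ≃ₗᵢ[ℝ] R) :=
  TopologicalSpace.induced (fun (S : R ≃ₗᵢ[ℝ] R) (r : R) => S r) Pi.topologicalSpace

end

/-! The kernel e^{-‖x-y‖} is bounded, translation invariant and 1-Lipschitz, and it determines the
norm. Translations are therefore isometries of both Φ(M(X)) and C_b(X), hence of the interpolation
space R, and what must be shown is that R is reflexive and that the norm of X can be read off the
action.

Reflexivity. X embeds densely in a metrizable compact space S through the functions e^{-‖x-d_n‖},
with (d_n) dense in X. Stability supplies the interchange of limits by which the kernel extends to a
symmetric separately continuous kernel on S (`IsExpExtension.exists_isSepContKernel`); points at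
infinity, where every extended function vanishes, are treated directly. Measures pushed forward to S
have weak-star limits along ultrafilters, and Fubini turns a functional applied to a potential into
the integral of a continuous function on S. Hence the inclusion of Φ(M(X)) in C_b(X) is weakly
compact (`isRelWeaklyCompact_incl`).

Real interpolation across a weakly compact inclusion gives a reflexive space
(`IsInterpolationSpace.isReflexiveSpace`). The norm of R is equivalent to the ℓ_p norm over the
integers of a weighted K-functional. Balls of this discrete norm are convex and closed in A₁, so
weak limits of bounded families stay in R. A bounded sequence of R which is null in A₁ cannot keep a
functional above ε > 0: suitable sums of m of its terms have norm O(m^{1/p}), against mε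
(`exists_apply_lt`). Separability then follows, since point evaluations on a dense sequence separate
the points of R.

Topology. Strong continuity of translations is dominated convergence for the discrete norm
(`tendsto_translation_sub`). Conversely, translating e^{-‖·‖} by z moves it in sup norm by at least
1 - e^{-‖z‖}, so its orbit map is uniformly inducing; completeness of X makes the image closed. -/

/-! ### Weak limits and relatively weakly compact sets -/

section WeakConvergence

variable {E : Type*} [NormedAddCommGroup E] [NormedSpace ℝ E]

/-- A closed convex set is closed under weak limits. -/
lemma Convex.mem_of_weak_tendsto {ι : Type*} {l : Filter ι} [l.NeBot] {s : Set E}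
    (hs : Convex ℝ s) (hsc : IsClosed s) {w : ι → E} {z : E}
    (hw : ∀ φ : StrongDual ℝ E, Tendsto (fun i => φ (w i)) l (𝓝 (φ z)))
    (hmem : ∀ᶠ i in l, w i ∈ s) : z ∈ s := by
  by_contra hz
  obtain ⟨φ, a, ha, haz⟩ := geometric_hahn_banach_closed_point hs hsc hz
  have : φ z ≤ a := le_of_tendsto (hw φ) (hmem.mono fun i hi => (ha _ hi).le)
  linarith

lemma norm_le_of_weak_tendsto {ι : Type*} {l : Filter ι} [l.NeBot] {w : ι → E} {z : E} {C : ℝ}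
    (hw : ∀ φ : StrongDual ℝ E, Tendsto (fun i => φ (w i)) l (𝓝 (φ z)))
    (hC : ∀ᶠ i in l, ‖w i‖ ≤ C) : ‖z‖ ≤ C := by
  have := (convex_closedBall (0 : E) C).mem_of_weak_tendsto Metric.isClosed_closedBall hw
    (by simpa using hC)
  simpa using this

/-- A set is relatively weakly compact if each ultrafilter on it converges weakly. -/
def IsRelWeaklyCompact (K : Set E) : Prop :=
  ∀ U : Ultrafilter E, K ∈ U → ∃ z : E, ∀ φ : StrongDual ℝ E, Tendsto φ U (𝓝 (φ z))

lemma IsRelWeaklyCompact.exists_tendsto {K : Set E} (hK : IsRelWeaklyCompact K) {ι : Type*}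
    (U : Ultrafilter ι) {w : ι → E} (hw : ∀ᶠ i in U, w i ∈ K) :
    ∃ z : E, ∀ φ : StrongDual ℝ E, Tendsto (fun i => φ (w i)) U (𝓝 (φ z)) := by
  obtain ⟨z, hz⟩ := hK (U.map w) hw
  exact ⟨z, fun φ => (hz φ).comp tendsto_map⟩

/-- A set which can be approximated uniformly by relatively weakly compact sets is relatively
weakly compact. -/
lemma IsRelWeaklyCompact.of_approx [CompleteSpace E] {K : Set E}
    (h : ∀ ε > 0, ∃ L : Set E, IsRelWeaklyCompact L ∧ ∀ x ∈ K, ∃ y ∈ L, ‖x - y‖ ≤ ε) :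
    IsRelWeaklyCompact K := by
  intro U hU
  have h' : ∀ n : ℕ, ∃ (z : E) (y : E → E), (∀ x ∈ K, ‖x - y x‖ ≤ 1 / ((n : ℝ) + 1)) ∧
      ∀ φ : StrongDual ℝ E, Tendsto (fun x => φ (y x)) U (𝓝 (φ z)) := by
    intro n
    obtain ⟨L, hL, hKL⟩ := h (1 / ((n : ℝ) + 1)) Nat.one_div_pos_of_nat
    choose! y hy hxy using hKL
    obtain ⟨z, hz⟩ := hL.exists_tendsto U (w := y) (mem_of_superset hU hy)
    exact ⟨z, y, hxy, hz⟩
  choose z y hy hz using h'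
  -- The two approximants lie near the same `x`, and norm bounds survive weak limits.
  have hcauchy : ∀ m n, ‖z m - z n‖ ≤ 1 / ((m : ℝ) + 1) + 1 / ((n : ℝ) + 1) := by
    intro m n
    refine norm_le_of_weak_tendsto (l := (U : Filter E)) (w := fun x => y m x - y n x) (fun φ => ?_)
      (mem_of_superset hU fun x hx => ?_)
    · simpa using (hz m φ).sub (hz n φ)
    · have := norm_sub_le (x - y n x) (x - y m x)
      rw [sub_sub_sub_cancel_left] at this
      change ‖y m x - y n x‖ ≤ _
      linarith [hy m x hx, hy n x hx]
  have h0 := tendsto_one_div_add_atTop_nhds_zero_nat (𝕜 := ℝ)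
  obtain ⟨w, hw⟩ : ∃ w, Tendsto z atTop (𝓝 w) := by
    refine cauchySeq_tendsto_of_complete (cauchySeq_of_le_tendsto_0
      (fun n : ℕ => 2 * (1 / ((n : ℝ) + 1))) (fun n m N hn hm => ?_)
      (by simpa using h0.const_mul 2))
    rw [dist_eq_norm]
    have h1 := Nat.one_div_le_one_div (α := ℝ) hn
    have h2 := Nat.one_div_le_one_div (α := ℝ) hm
    linarith [hcauchy n m]
  refine ⟨w, fun φ => ?_⟩
  refine Metric.tendsto_nhds.2 fun ε hε => ?_
  have hlim : Tendsto (fun n : ℕ => ‖φ‖ * (1 / ((n : ℝ) + 1)) + |φ (z n) - φ w|) atTop (𝓝 0) := by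
    have := (((φ.continuous.tendsto w).comp hw).sub_const (φ w)).abs
    simpa using (h0.const_mul ‖φ‖).add this
  obtain ⟨n, hn⟩ := (hlim.eventually (gt_mem_nhds (half_pos hε))).exists
  filter_upwards [hU, Metric.tendsto_nhds.1 (hz n φ) (ε / 2) (half_pos hε)] with x hx hx2
  rw [Real.dist_eq] at hx2 ⊢
  have h3 : |φ x - φ (y n x)| ≤ ‖φ‖ * (1 / ((n : ℝ) + 1)) := by
    rw [← map_sub]
    exact (φ.le_opNorm _).trans (by gcongr; exact hy n x hx)
  have := abs_sub_le (φ x) (φ (y n x)) (φ w)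
  have := abs_sub_le (φ (y n x)) (φ (z n)) (φ w)
  linarith

lemma IsRelWeaklyCompact.smul {K : Set E} (hK : IsRelWeaklyCompact K) (c : ℝ) :
    IsRelWeaklyCompact {x | ∃ y ∈ K, x = c • y} := by
  intro U hU
  have : ∀ x ∈ {x | ∃ y ∈ K, x = c • y}, ∃ y ∈ K, x = c • y := fun x hx => hx
  choose! y hy hxy using this
  obtain ⟨z, hz⟩ := hK.exists_tendsto U (w := y) (mem_of_superset hU hy)
  refine ⟨c • z, fun φ => ?_⟩
  rw [map_smul]
  refine ((hz φ).const_smul c).congr' (mem_of_superset hU fun x hx => ?_)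
  change c • φ (y x) = φ x
  rw [← map_smul, ← hxy x hx]

end WeakConvergence

/-! ### Goldstine's theorem and separability by duality -/

section Bidual

variable {E : Type*} [NormedAddCommGroup E] [NormedSpace ℝ E]

/-- Helly's finite-dimensional form of Goldstine. A separating functional on ℝ^ι pulls back to a
combination `ψ` of the `φ i` which is at most `a` on the ball, so `‖ψ‖ ≤ a / (‖Ξ‖ + 1)`,
contradicting `a < Ξ ψ`. The added 1 keeps the radius positive when `Ξ = 0`. -/
lemma mem_closure_image_of_bidual (Ξ : StrongDual ℝ (StrongDual ℝ E)) {ι : Type*} [Finite ι]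
    (φ : ι → StrongDual ℝ E) :
    (fun i => Ξ (φ i)) ∈
      closure ((fun (r : E) (i : ι) => φ i r) '' Metric.closedBall 0 (‖Ξ‖ + 1)) := by
  classical
  have := Fintype.ofFinite ι
  by_contra hz
  have hconv : Convex ℝ ((fun (r : E) (i : ι) => φ i r) '' Metric.closedBall 0 (‖Ξ‖ + 1)) :=
    (convex_closedBall (0 : E) _).linear_image
      (LinearMap.pi fun i => (φ i : E →ₗ[ℝ] ℝ))
  obtain ⟨f, a, ha, haz⟩ := geometric_hahn_banach_closed_point hconv.closure isClosed_closure hz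
  set ψ : StrongDual ℝ E := ∑ i, f (Pi.single i 1) • φ i with hψ
  have hf : ∀ v : ι → ℝ, f v = ∑ i, f (Pi.single i 1) * v i := fun v => by
    have := LinearMap.pi_apply_eq_sum_univ (f : (ι → ℝ) →ₗ[ℝ] ℝ) v
    simp only [ContinuousLinearMap.coe_coe] at this
    rw [this]
    refine Finset.sum_congr rfl fun i _ => ?_
    rw [smul_eq_mul, mul_comm]
    congr 2
    ext j
    simp [Pi.single_apply, eq_comm]
  have hψr : ∀ r, f (fun i => φ i r) = ψ r := fun r => by
    rw [hf, hψ]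
    simp
  have hψΞ : f (fun i => Ξ (φ i)) = Ξ ψ := by
    rw [hf, hψ]
    simp
  have hball : ∀ r : E, ‖r‖ ≤ ‖Ξ‖ + 1 → ψ r ≤ a := fun r hr => by
    rw [← hψr]
    exact (ha _ (subset_closure ⟨r, by simpa using hr, rfl⟩)).le
  have ha0 : 0 ≤ a := by
    have := hball 0 (by simpa using by positivity)
    simpa using this
  have hpos : 0 < ‖Ξ‖ + 1 := by positivity
  have hnorm : ‖ψ‖ ≤ a / (‖Ξ‖ + 1) := by
    refine ContinuousLinearMap.opNorm_le_of_ball hpos (by positivity) fun r hr => ?_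
    rcases eq_or_ne r 0 with rfl | hr0
    · simp
    have hr' : 0 < ‖r‖ := norm_pos_iff.2 hr0
    have key : ∀ s : E, ‖s‖ = ‖r‖ → ψ s ≤ a / (‖Ξ‖ + 1) * ‖r‖ := fun s hs => by
      have := hball (((‖Ξ‖ + 1) / ‖r‖) • s) (by
        rw [norm_smul, hs, Real.norm_of_nonneg (by positivity)]
        field_simp
        exact le_rfl)
      rw [map_smul, smul_eq_mul] at this
      rw [div_mul_eq_mul_div, le_div_iff₀ hpos]
      rw [div_mul_eq_mul_div, div_le_iff₀ hr'] at this
      linarith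
    rw [Real.norm_eq_abs]
    refine abs_le'.2 ⟨key r rfl, ?_⟩
    rw [← map_neg]
    exact key _ (norm_neg r)
  have h1 : Ξ ψ ≤ ‖Ξ‖ * (a / (‖Ξ‖ + 1)) :=
    (le_abs_self _).trans ((Ξ.le_opNorm ψ).trans (by gcongr))
  have h2 : ‖Ξ‖ * (a / (‖Ξ‖ + 1)) ≤ a := by
    rw [mul_div_assoc', div_le_iff₀ hpos]
    nlinarith [norm_nonneg Ξ]
  rw [hψΞ] at haz
  linarith

/-- **Goldstine's theorem**: each element of the bidual is the weak-star limit of a bounded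
ultrafilter on the space. -/
lemma exists_ultrafilter_tendsto_bidual (Ξ : StrongDual ℝ (StrongDual ℝ E)) :
    ∃ U : Ultrafilter E, (∀ᶠ r in (U : Filter E), ‖r‖ ≤ ‖Ξ‖ + 1) ∧
      ∀ φ : StrongDual ℝ E, Tendsto φ U (𝓝 (Ξ φ)) := by
  let e : E → (StrongDual ℝ E → ℝ) := fun r φ => φ r
  let B : Set E := Metric.closedBall 0 (‖Ξ‖ + 1)
  have hne : (comap e (𝓝 fun φ => Ξ φ) ⊓ 𝓟 B).NeBot := by
    refine inf_principal_neBot_iff.2 fun V hV => ?_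
    obtain ⟨W, hW, hWV⟩ := mem_comap.1 hV
    obtain ⟨O, hOW, hO, hΞO⟩ := mem_nhds_iff.1 hW
    obtain ⟨I, v, hv, hIv⟩ := isOpen_pi_iff.1 hO _ hΞO
    have hmem := mem_closure_image_of_bidual Ξ (fun φ : I => (φ : StrongDual ℝ E))
    have hopen : IsOpen (Set.univ.pi fun φ : I => v φ) :=
      isOpen_set_pi finite_univ fun φ _ => (hv φ φ.2).1
    obtain ⟨_, hy, r, hr, rfl⟩ := mem_closure_iff.1 hmem _ hopen
      (fun φ _ => (hv φ φ.2).2)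
    exact ⟨r, hWV (hOW (hIv fun φ hφ => hy ⟨φ, hφ⟩ (mem_univ _))), hr⟩
  obtain ⟨U, hU⟩ := Ultrafilter.exists_le (comap e (𝓝 fun φ => Ξ φ) ⊓ 𝓟 B)
  refine ⟨U, ?_, fun φ => ?_⟩
  · have : B ∈ (U : Filter E) := hU (mem_inf_of_right (mem_principal_self B))
    filter_upwards [this] with r hr
    simpa [B] using hr
  · have : Tendsto e U (𝓝 fun φ => Ξ φ) := tendsto_iff_comap.2 (hU.trans inf_le_left)
    exact (tendsto_pi_nhds.1 this) φ

/-- A normed space is separable if no nonzero functional vanishes on some sequence. -/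
lemma separableSpace_of_forall_dual_eq_zero (x : ℕ → E)
    (hx : ∀ f : StrongDual ℝ E, (∀ n, f (x n) = 0) → f = 0) :
    TopologicalSpace.SeparableSpace E := by
  have htop : (Submodule.span ℝ (range x)).topologicalClosure = ⊤ := by
    by_contra hne
    obtain ⟨y, hy⟩ : ∃ y, y ∉ (Submodule.span ℝ (range x)).topologicalClosure := by
      by_contra! hall
      exact hne (Submodule.eq_top_iff'.2 hall)
    obtain ⟨f, a, ha, hay⟩ := geometric_hahn_banach_closed_point
      (Submodule.convex (Submodule.span ℝ (range x)).topologicalClosure)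
      (Submodule.isClosed_topologicalClosure _) hy
    have hf0 : f = 0 := hx f fun n => by
      by_contra hfn
      have := ha (((a + 1) / f (x n)) • x n) (Submodule.smul_mem _ _
        (Submodule.le_topologicalClosure _ (Submodule.subset_span ⟨n, rfl⟩)))
      rw [map_smul, smul_eq_mul, div_mul_cancel₀ _ hfn] at this
      linarith
    have := ha 0 (Submodule.zero_mem _)
    simp only [hf0, zero_apply] at this hay
    linarith
  have hsep : TopologicalSpace.IsSeparable (range x) := (countable_range x).isSeparable
  have := (hsep.span (R := ℝ)).closure
  rw [← Submodule.topologicalClosure_coe, htop] at this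
  exact TopologicalSpace.isSeparable_univ_iff.1 (by simpa using this)

/-- A normed space whose dual is separable is separable. -/
lemma separableSpace_of_separableSpace_dual [TopologicalSpace.SeparableSpace (StrongDual ℝ E)] :
    TopologicalSpace.SeparableSpace E := by
  let D : ℕ → StrongDual ℝ E := TopologicalSpace.denseSeq _
  have hx : ∀ n, ∃ x : E, ‖x‖ ≤ 1 ∧ ‖D n‖ / 2 ≤ ‖D n x‖ := fun n => by
    by_contra! hcon
    have h0 := hcon 0 (by simp)
    have hle : ‖D n‖ ≤ ‖D n‖ / 2 := by
      refine ContinuousLinearMap.opNorm_le_of_unit_norm (by positivity) fun x hx =>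
        (hcon x hx.le).le
    simp only [map_zero, norm_zero] at h0
    linarith
  choose x hx1 hx2 using hx
  refine separableSpace_of_forall_dual_eq_zero x fun f hf0 => ?_
  by_contra hfne
  have hfpos : 0 < ‖f‖ := norm_pos_iff.2 hfne
  -- Since `f` vanishes at `x n`, being within `‖f‖ / 4` of `f` gives `‖D n‖ < ‖f‖ / 2`, while the
  -- triangle inequality gives `‖D n‖ > 3 ‖f‖ / 4`.
  obtain ⟨_, hn, n, rfl⟩ := Metric.dense_iff.1 (TopologicalSpace.denseRange_denseSeq
    (StrongDual ℝ E)) f (‖f‖ / 4) (by positivity)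
  rw [Metric.mem_ball, dist_eq_norm] at hn
  have h1 : ‖D n (x n)‖ ≤ ‖D n - f‖ := by
    have := (D n - f).le_opNorm (x n)
    rw [sub_apply, hf0, sub_zero] at this
    nlinarith [hx1 n, norm_nonneg (D n - f)]
  have h2 := norm_sub_norm_le f (D n)
  rw [norm_sub_rev] at h2
  linarith [hx2 n]

end Bidual

/-! ### The K-functional and its discrete ℓ_p norm -/

section KFunctional

variable {A₀ A₁ : Type*} [NormedAddCommGroup A₀] [NormedSpace ℝ A₀]
  [NormedAddCommGroup A₁] [NormedSpace ℝ A₁]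

lemma bddBelow_range_K (ι : A₀ →L[ℝ] A₁) (θ t : ℝ) (z : A₁) : BddBelow (range fun x : A₀ =>
    Real.exp (θ * t) * ‖x‖ + Real.exp (-(1 - θ) * t) * ‖z - ι x‖) :=
  ⟨0, by rintro _ ⟨x, rfl⟩; positivity⟩

/-- This and the next lemma speak of the raw infimum because they prove the seminorm axioms in the
definition of `interpK`. -/
lemma exists_decomp_of_iInf_lt (ι : A₀ →L[ℝ] A₁) (θ t : ℝ) {z : A₁} {a : ℝ}
    (h : (⨅ x : A₀, Real.exp (θ * t) * ‖x‖ + Real.exp (-(1 - θ) * t) * ‖z - ι x‖) < a) :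
    ∃ x y, z = ι x + y ∧ Real.exp (θ * t) * ‖x‖ + Real.exp (-(1 - θ) * t) * ‖y‖ < a := by
  obtain ⟨x, hx⟩ := exists_lt_of_ciInf_lt h
  exact ⟨x, z - ι x, by simp, hx⟩

lemma iInf_le_of_decomp (ι : A₀ →L[ℝ] A₁) (θ t : ℝ) {z : A₁} {x : A₀} {y : A₁}
    (h : z = ι x + y) :
    (⨅ x : A₀, Real.exp (θ * t) * ‖x‖ + Real.exp (-(1 - θ) * t) * ‖z - ι x‖) ≤
      Real.exp (θ * t) * ‖x‖ + Real.exp (-(1 - θ) * t) * ‖y‖ := by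
  have := ciInf_le (bddBelow_range_K ι θ t z) x
  rwa [h, add_sub_cancel_left, ← h] at this

/-- The `K`-functional of the couple `(A₀, A₁)` with the weights of the real method. -/
noncomputable def interpK (ι : A₀ →L[ℝ] A₁) (θ t : ℝ) : Seminorm ℝ A₁ :=
  Seminorm.ofSMulLE
    (fun z => ⨅ x : A₀, Real.exp (θ * t) * ‖x‖ + Real.exp (-(1 - θ) * t) * ‖z - ι x‖)
    (le_antisymm (by simpa using iInf_le_of_decomp ι θ t (z := 0) (x := 0) (y := 0) (by simp))
      (Real.iInf_nonneg fun x => by positivity))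
    (fun z w => by
      refine le_of_forall_pos_lt_add fun ε hε => ?_
      obtain ⟨x, y, h, hlt⟩ := exists_decomp_of_iInf_lt ι θ t (z := z)
        (lt_add_of_pos_right _ (half_pos hε))
      obtain ⟨x', y', h', hlt'⟩ := exists_decomp_of_iInf_lt ι θ t (z := w)
        (lt_add_of_pos_right _ (half_pos hε))
      have h1 := iInf_le_of_decomp ι θ t (z := z + w) (x := x + x') (y := y + y')
        (by rw [h, h', map_add]; abel)
      have h2 : Real.exp (θ * t) * ‖x + x'‖ ≤ Real.exp (θ * t) * (‖x‖ + ‖x'‖) := by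
        gcongr; exact norm_add_le _ _
      have h3 : Real.exp (-(1 - θ) * t) * ‖y + y'‖ ≤ Real.exp (-(1 - θ) * t) * (‖y‖ + ‖y'‖) := by
        gcongr; exact norm_add_le _ _
      linarith)
    (fun c z => by
      rw [Real.mul_iInf_of_nonneg (norm_nonneg c)]
      refine le_ciInf fun x => ?_
      refine (iInf_le_of_decomp ι θ t (z := c • z) (x := c • x) (y := c • (z - ι x))
        (by rw [map_smul, smul_sub]; abel)).trans_eq ?_
      rw [norm_smul, norm_smul]
      ring)

variable (ι : A₀ →L[ℝ] A₁) (θ : ℝ)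

lemma interpK_le_of_decomp (t : ℝ) {z : A₁} {x : A₀} {y : A₁} (h : z = ι x + y) :
    interpK ι θ t z ≤ Real.exp (θ * t) * ‖x‖ + Real.exp (-(1 - θ) * t) * ‖y‖ :=
  iInf_le_of_decomp ι θ t h

lemma exists_decomp_of_interpK_lt (t : ℝ) {z : A₁} {a : ℝ} (h : interpK ι θ t z < a) :
    ∃ x y, z = ι x + y ∧ Real.exp (θ * t) * ‖x‖ + Real.exp (-(1 - θ) * t) * ‖y‖ < a :=
  exists_decomp_of_iInf_lt ι θ t h

lemma interpK_le_norm (t : ℝ) (z : A₁) :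
    interpK ι θ t z ≤ Real.exp (-(1 - θ) * t) * ‖z‖ := by
  simpa using interpK_le_of_decomp ι θ t (z := z) (x := 0) (y := z) (by simp)

/-- With `interpK_le_norm`, this makes each `interpK` an equivalent norm of A₁. The two terms of the
constant undo the two weights. -/
lemma norm_le_interpK (t : ℝ) (z : A₁) :
    ‖z‖ ≤ (‖ι‖ * Real.exp (-(θ * t)) + Real.exp ((1 - θ) * t)) * interpK ι θ t z := by
  set C := ‖ι‖ * Real.exp (-(θ * t)) + Real.exp ((1 - θ) * t) with hC
  have hCpos : 0 < C := by positivity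
  rw [← div_le_iff₀' hCpos]
  refine le_of_forall_gt_imp_ge_of_dense fun a ha => ?_
  obtain ⟨x, y, h, hlt⟩ := exists_decomp_of_interpK_lt ι θ t ha
  rw [div_le_iff₀' hCpos]
  have h1 : ‖z‖ ≤ ‖ι‖ * ‖x‖ + ‖y‖ := by
    rw [h]
    exact (norm_add_le _ _).trans (by gcongr; exact ι.le_opNorm x)
  have e1 : ‖x‖ = Real.exp (-(θ * t)) * (Real.exp (θ * t) * ‖x‖) := by
    rw [← mul_assoc, ← Real.exp_add, neg_add_cancel, Real.exp_zero, one_mul]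
  have e2 : ‖y‖ = Real.exp ((1 - θ) * t) * (Real.exp (-(1 - θ) * t) * ‖y‖) := by
    rw [← mul_assoc, ← Real.exp_add, neg_mul, add_neg_cancel, Real.exp_zero, one_mul]
  have hx : 0 ≤ Real.exp (θ * t) * ‖x‖ := by positivity
  have hy : 0 ≤ Real.exp (-(1 - θ) * t) * ‖y‖ := by positivity
  rw [e1, e2] at h1
  refine h1.trans ?_
  have hp1 : 0 ≤ ‖ι‖ * Real.exp (-(θ * t)) := by positivity
  have hp2 := (Real.exp_pos ((1 - θ) * t)).le
  rw [hC]
  nlinarith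

lemma interpK_pos (t : ℝ) {z : A₁} (hz : z ≠ 0) : 0 < interpK ι θ t z := by
  by_contra! h
  have := norm_le_interpK ι θ t z
  have h0 : interpK ι θ t z = 0 := le_antisymm h (apply_nonneg _ _)
  rw [h0, mul_zero] at this
  exact hz (norm_le_zero_iff.1 this)

/-- The discrete version of the norm of `[A₀, A₁]_{θ,p}`. -/
noncomputable def interpDisc (p : ℝ) (z : A₁) : ℝ≥0∞ :=
  eLpNorm (fun n : ℤ => interpK ι θ n z) (ENNReal.ofReal p) Measure.count

/-- Each interval [n, n + 1) has length one; thus ℓ_p norms over the integers become L_p norms of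
step functions. -/
lemma measurePreserving_floor : MeasurePreserving (fun t : ℝ => ⌊t⌋) volume Measure.count := by
  refine ⟨Int.measurable_floor, ?_⟩
  refine Measure.ext_iff_singleton.2 fun n => ?_
  rw [Measure.map_apply Int.measurable_floor (measurableSet_singleton n),
    Int.preimage_floor_singleton]
  simp

variable {ι θ}

lemma interpK_le_interpDisc {p : ℝ} (hp : 1 < p) (n : ℤ) (z : A₁) :
    ENNReal.ofReal (interpK ι θ n z) ≤ interpDisc ι θ p z := by
  have := enorm_le_eLpNorm_count (fun n : ℤ => interpK ι θ n z) n (p := ENNReal.ofReal p)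
    (by simpa using by linarith)
  rwa [Real.enorm_of_nonneg (apply_nonneg _ _)] at this

/-- The decomposition at time `t` is a competitor for the K-functional at `⌊t⌋`. Passing from `t` to
`⌊t⌋` lowers the first weight and raises the second by a factor at most e. -/
lemma interpDisc_le_of_rep {p : ℝ} (hθ₀ : 0 < θ) (hp : 1 < p) {z : A₁}
    {x₁ : ℝ → A₀} {x₂ : ℝ → A₁} (h : IsInterpRep ι θ p z x₁ x₂) :
    interpDisc ι θ p z ≤
      eLpNorm (fun t => Real.exp (θ * t) • x₁ t) (ENNReal.ofReal p) volume +
      ENNReal.ofReal (Real.exp 1) *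
        eLpNorm (fun t => Real.exp (-(1 - θ) * t) • x₂ t) (ENNReal.ofReal p) volume := by
  have h1p : 1 ≤ ENNReal.ofReal p := by simpa using hp.le
  rw [interpDisc, ← eLpNorm_comp_measurePreserving (Measurable.of_discrete).aestronglyMeasurable
    measurePreserving_floor]
  refine (eLpNorm_mono_real (g := (fun t => ‖Real.exp (θ * t) • x₁ t‖) + Real.exp 1 •
    fun t => ‖Real.exp (-(1 - θ) * t) • x₂ t‖) fun t => ?_).trans
    ((eLpNorm_add_le h.memLp₁.1.norm (h.memLp₂.1.norm.const_smul _) h1p).trans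
      (add_le_add (eLpNorm_norm _).le (eLpNorm_const_smul_le.trans_eq ?_)))
  · rw [Function.comp_apply, Real.norm_of_nonneg (apply_nonneg _ _)]
    refine (interpK_le_of_decomp ι θ _ (h.eq_add t)).trans ?_
    simp only [Pi.add_apply, Pi.smul_apply, norm_smul, smul_eq_mul, Real.norm_eq_abs, Real.abs_exp]
    have hf := Int.floor_le t
    have hf' := Int.lt_floor_add_one t
    have e1 : Real.exp (θ * ⌊t⌋) ≤ Real.exp (θ * t) := by gcongr
    have e2 : Real.exp (-(1 - θ) * ⌊t⌋) ≤ Real.exp 1 * Real.exp (-(1 - θ) * t) := by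
      rw [← Real.exp_add]
      refine Real.exp_le_exp.2 ?_
      nlinarith
    rw [← mul_assoc]
    gcongr
  · rw [Real.enorm_of_nonneg (Real.exp_pos 1).le, eLpNorm_norm]

/-- The estimate shared by the A₀ and A₁ components of a step-function representation. -/
lemma memLp_smul_step {B : Type*} [NormedAddCommGroup B] [NormedSpace ℝ B] {p : ℝ} {z : A₁}
    (h : interpDisc ι θ p z ≠ ⊤) {w : ℝ → ℝ} (v : ℤ → B) (hw : Continuous w) {C : ℝ} (hC : 0 ≤ C)
    (hwv : ∀ t, ‖w t • v ⌊t⌋‖ ≤ C * interpK ι θ ⌊t⌋ z) :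
    MemLp (fun t => w t • v ⌊t⌋) (ENNReal.ofReal p) volume ∧
      eLpNorm (fun t => w t • v ⌊t⌋) (ENNReal.ofReal p) volume ≤
        ENNReal.ofReal C * interpDisc ι θ p z := by
  have hle : eLpNorm (fun t => w t • v ⌊t⌋) (ENNReal.ofReal p) volume ≤
      ENNReal.ofReal C * interpDisc ι θ p z := by
    refine (eLpNorm_mono_real (g := C •
      ((fun n : ℤ => interpK ι θ n z) ∘ fun t : ℝ => ⌊t⌋)) hwv).trans ?_
    refine eLpNorm_const_smul_le.trans_eq ?_
    rw [eLpNorm_comp_measurePreserving (Measurable.of_discrete).aestronglyMeasurable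
      measurePreserving_floor, Real.enorm_of_nonneg hC, interpDisc]
  refine ⟨⟨?_, hle.trans_lt (ENNReal.mul_lt_top ENNReal.ofReal_lt_top h.lt_top)⟩, hle⟩
  have hv : StronglyMeasurable v := StronglyMeasurable.of_discrete
  exact (hw.stronglyMeasurable.smul
    (hv.comp_measurable Int.measurable_floor)).aestronglyMeasurable

/-- If the discrete norm of `z` is finite, then `z` has a representation by step functions. -/
lemma exists_rep_of_interpDisc {p : ℝ} (hθ₀ : 0 < θ) (hθ₁ : θ < 1) {z : A₁}
    (h : interpDisc ι θ p z ≠ ⊤) : ∃ x₁ x₂, IsInterpRep ι θ p z x₁ x₂ ∧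
      eLpNorm (fun t => Real.exp (θ * t) • x₁ t) (ENNReal.ofReal p) volume ≤
        ENNReal.ofReal (2 * Real.exp 1) * interpDisc ι θ p z ∧
      eLpNorm (fun t => Real.exp (-(1 - θ) * t) • x₂ t) (ENNReal.ofReal p) volume ≤
        ENNReal.ofReal (2 * Real.exp 1) * interpDisc ι θ p z := by
  have hdec : ∀ n : ℤ, ∃ x y, z = ι x + y ∧
      Real.exp (θ * n) * ‖x‖ + Real.exp (-(1 - θ) * n) * ‖y‖ ≤ 2 * interpK ι θ n z := by
    intro n
    -- A decomposition within a factor 2 of the infimum is available only when the infimum is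
    -- positive.
    rcases eq_or_ne z 0 with rfl | hz
    · exact ⟨0, 0, by simp, by simp⟩
    · have := interpK_pos ι θ n hz
      obtain ⟨x, y, h1, h2⟩ := exists_decomp_of_interpK_lt ι θ n
        (show interpK ι θ n z < 2 * interpK ι θ n z by linarith)
      exact ⟨x, y, h1, h2.le⟩
  choose x y hxy hle using hdec
  have h1 := memLp_smul_step h (w := fun t => Real.exp (θ * t)) x (by fun_prop)
    (C := 2 * Real.exp 1) (by positivity) fun t => by
    rw [norm_smul, Real.norm_eq_abs, Real.abs_exp]
    have hf' := Int.lt_floor_add_one t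
    have e1 : Real.exp (θ * t) ≤ Real.exp 1 * Real.exp (θ * ⌊t⌋) := by
      rw [← Real.exp_add]
      refine Real.exp_le_exp.2 ?_
      nlinarith
    have hy : 0 ≤ Real.exp (-(1 - θ) * ⌊t⌋) * ‖y ⌊t⌋‖ := by positivity
    calc Real.exp (θ * t) * ‖x ⌊t⌋‖ ≤ Real.exp 1 * Real.exp (θ * ⌊t⌋) * ‖x ⌊t⌋‖ := by gcongr
      _ ≤ Real.exp 1 * (2 * interpK ι θ ⌊t⌋ z) := by
        rw [mul_assoc]
        exact mul_le_mul_of_nonneg_left (by linarith [hle ⌊t⌋]) (Real.exp_pos 1).le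
      _ = _ := by ring
  have h2 := memLp_smul_step h (w := fun t => Real.exp (-(1 - θ) * t)) y (by fun_prop)
    (C := 2 * Real.exp 1) (by positivity) fun t => by
    rw [norm_smul, Real.norm_eq_abs, Real.abs_exp]
    have hf := Int.floor_le t
    have e1 : Real.exp (-(1 - θ) * t) ≤ Real.exp 1 * Real.exp (-(1 - θ) * ⌊t⌋) := by
      rw [← Real.exp_add]
      refine Real.exp_le_exp.2 ?_
      nlinarith
    have hx : 0 ≤ Real.exp (θ * ⌊t⌋) * ‖x ⌊t⌋‖ := by positivity
    calc Real.exp (-(1 - θ) * t) * ‖y ⌊t⌋‖ ≤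
        Real.exp 1 * Real.exp (-(1 - θ) * ⌊t⌋) * ‖y ⌊t⌋‖ := by gcongr
      _ ≤ Real.exp 1 * (2 * interpK ι θ ⌊t⌋ z) := by
        rw [mul_assoc]
        exact mul_le_mul_of_nonneg_left (by linarith [hle ⌊t⌋]) (Real.exp_pos 1).le
      _ = _ := by ring
  exact ⟨fun t => x ⌊t⌋, fun t => y ⌊t⌋, ⟨fun t => hxy _, h1.1, h2.1⟩, h1.2, h2.2⟩

end KFunctional

/-! ### The norm of the interpolation space -/

section InterpNorm

variable {A₀ A₁ : Type*} [NormedAddCommGroup A₀] [NormedSpace ℝ A₀]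
  [NormedAddCommGroup A₁] [NormedSpace ℝ A₁] {ι : A₀ →L[ℝ] A₁} {θ p : ℝ}

lemma interpNorm_nonneg (z : A₁) : 0 ≤ interpNorm ι θ p z := by
  refine Real.sInf_nonneg ?_
  rintro _ ⟨x₁, x₂, -, rfl⟩
  positivity

/-- A weighted geometric mean is at most the maximum. -/
lemma interpNorm_le_of_rep (hθ₀ : 0 < θ) (hθ₁ : θ < 1) {z : A₁} {x₁ : ℝ → A₀} {x₂ : ℝ → A₁}
    (h : IsInterpRep ι θ p z x₁ x₂) {c : ℝ}
    (h₁ : (eLpNorm (fun t => Real.exp (θ * t) • x₁ t) (ENNReal.ofReal p) volume).toReal ≤ c)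
    (h₂ : (eLpNorm (fun t => Real.exp (-(1 - θ) * t) • x₂ t) (ENNReal.ofReal p) volume).toReal
      ≤ c) : interpNorm ι θ p z ≤ c := by
  have hc : 0 ≤ c := ENNReal.toReal_nonneg.trans h₁
  have h0 : interpNorm ι θ p z ≤
      (eLpNorm (fun t => Real.exp (θ * t) • x₁ t) (ENNReal.ofReal p) volume).toReal ^ (1 - θ) *
      (eLpNorm (fun t => Real.exp (-(1 - θ) * t) • x₂ t) (ENNReal.ofReal p) volume).toReal ^ θ := by
    refine csInf_le ⟨0, ?_⟩ ⟨x₁, x₂, h, rfl⟩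
    rintro _ ⟨x₁, x₂, -, rfl⟩
    positivity
  refine h0.trans ?_
  · calc _ ≤ c ^ (1 - θ) * c ^ θ := by gcongr
      _ = c := by
        rw [← Real.rpow_add_of_nonneg hc (by linarith) hθ₀.le]
        simp

lemma memLp_exp_smul_shift {B : Type*} [NormedAddCommGroup B] [NormedSpace ℝ B] {q : ℝ≥0∞}
    (a s : ℝ) {x : ℝ → B} (hx : MemLp (fun t => Real.exp (a * t) • x t) q volume) :
    MemLp (fun t => Real.exp (a * t) • x (t + s)) q volume ∧
      (eLpNorm (fun t => Real.exp (a * t) • x (t + s)) q volume).toReal ≤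
        Real.exp (-(a * s)) * (eLpNorm (fun t => Real.exp (a * t) • x t) q volume).toReal := by
  have hmp := measurePreserving_add_right (volume : Measure ℝ) s
  have heq : (fun t => Real.exp (a * t) • x (t + s)) =
      Real.exp (-(a * s)) • ((fun t => Real.exp (a * t) • x t) ∘ fun t => t + s) := by
    ext t
    simp only [Pi.smul_apply, Function.comp_apply, smul_smul, ← Real.exp_add]
    congr 2
    ring
  rw [heq]
  refine ⟨(hx.comp_measurePreserving hmp).const_smul _, ?_⟩
  have h1 : eLpNorm (Real.exp (-(a * s)) • ((fun t => Real.exp (a * t) • x t) ∘ fun t => t + s))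
      q volume ≤ ENNReal.ofReal (Real.exp (-(a * s))) *
        eLpNorm (fun t => Real.exp (a * t) • x t) q volume := by
    refine eLpNorm_const_smul_le.trans_eq ?_
    rw [Real.enorm_of_nonneg (Real.exp_pos _).le, eLpNorm_comp_measurePreserving hx.1 hmp]
  have h2 := ENNReal.toReal_mono (ENNReal.mul_ne_top ENNReal.ofReal_ne_top hx.2.ne) h1
  rwa [ENNReal.toReal_mul, ENNReal.toReal_ofReal (Real.exp_pos _).le] at h2

/-- The two factors e^{-θs} and e^{(1-θ)s}, raised to the powers 1 - θ and θ, cancel in the product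
defining the norm. This freedom allows the two L_p norms to be balanced. -/
lemma IsInterpRep.shift {z : A₁} {x₁ : ℝ → A₀} {x₂ : ℝ → A₁} (h : IsInterpRep ι θ p z x₁ x₂)
    (s : ℝ) : IsInterpRep ι θ p z (fun t => x₁ (t + s)) (fun t => x₂ (t + s)) ∧
      (eLpNorm (fun t => Real.exp (θ * t) • x₁ (t + s)) (ENNReal.ofReal p) volume).toReal ≤
        Real.exp (-(θ * s)) *
          (eLpNorm (fun t => Real.exp (θ * t) • x₁ t) (ENNReal.ofReal p) volume).toReal ∧
      (eLpNorm (fun t => Real.exp (-(1 - θ) * t) • x₂ (t + s)) (ENNReal.ofReal p) volume).toReal ≤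
        Real.exp ((1 - θ) * s) *
          (eLpNorm (fun t => Real.exp (-(1 - θ) * t) • x₂ t) (ENNReal.ofReal p) volume).toReal := by
  have h1 := memLp_exp_smul_shift θ s h.memLp₁
  have h2 := memLp_exp_smul_shift (-(1 - θ)) s h.memLp₂
  rw [show -(-(1 - θ) * s) = (1 - θ) * s by ring] at h2
  exact ⟨⟨fun t => h.eq_add _, h1.1, h2.1⟩, h1.2, h2.2⟩

/-- The norm of the interpolation space is also the infimum of
`max (‖exp(θ t) x₁(t)‖_p) (‖exp(-(1 - θ) t) x₂(t)‖_p)`. -/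
lemma exists_rep_of_interpNorm_lt (hθ₀ : 0 < θ) (hθ₁ : θ < 1) {z : A₁}
    (hz : z ∈ interpSet ι θ p) {c : ℝ}
    (hc : interpNorm ι θ p z < c) : ∃ x₁ x₂, IsInterpRep ι θ p z x₁ x₂ ∧
      (eLpNorm (fun t => Real.exp (θ * t) • x₁ t) (ENNReal.ofReal p) volume).toReal < c ∧
      (eLpNorm (fun t => Real.exp (-(1 - θ) * t) • x₂ t) (ENNReal.ofReal p) volume).toReal
        < c := by
  obtain ⟨y₁, y₂, hy⟩ := hz
  rw [interpNorm] at hc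
  obtain ⟨_, ⟨x₁, x₂, h, rfl⟩, hlt⟩ := exists_lt_of_csInf_lt (by exact ⟨_, y₁, y₂, hy, rfl⟩) hc
  set a := (eLpNorm (fun t => Real.exp (θ * t) • x₁ t) (ENNReal.ofReal p) volume).toReal with ha
  set b := (eLpNorm (fun t => Real.exp (-(1 - θ) * t) • x₂ t) (ENNReal.ofReal p) volume).toReal
    with hb
  have ha0 : 0 ≤ a := ENNReal.toReal_nonneg
  have hb0 : 0 ≤ b := ENNReal.toReal_nonneg
  -- Either norm may be zero; adding `δ` makes the logarithms meaningful.
  obtain ⟨δ, hδ, hδc⟩ : ∃ δ > 0, (a + δ) ^ (1 - θ) * (b + δ) ^ θ < c := by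
    have hcont : Continuous fun δ : ℝ => (a + δ) ^ (1 - θ) * (b + δ) ^ θ :=
      ((continuous_const.add continuous_id).rpow_const fun _ => Or.inr (by linarith)).mul
        ((continuous_const.add continuous_id).rpow_const fun _ => Or.inr hθ₀.le)
    have := (hcont.tendsto 0).eventually_lt_const (u := c) (by simpa using hlt)
    obtain ⟨δ, h1, h2⟩ := ((this.filter_mono nhdsWithin_le_nhds).and
      (self_mem_nhdsWithin (s := Ioi (0 : ℝ)))).exists
    exact ⟨δ, h2, h1⟩
  have hA : 0 < a + δ := by linarith
  have hB : 0 < b + δ := by linarith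
  -- This shift makes both rescaled bounds equal to the geometric mean.
  set s := Real.log (a + δ) - Real.log (b + δ) with hs
  have e0 : (a + δ) ^ (1 - θ) * (b + δ) ^ θ =
      Real.exp (Real.log (a + δ) * (1 - θ) + Real.log (b + δ) * θ) := by
    rw [Real.rpow_def_of_pos hA, Real.rpow_def_of_pos hB, Real.exp_add]
  have e1 : Real.exp (-(θ * s)) * (a + δ) = (a + δ) ^ (1 - θ) * (b + δ) ^ θ := by
    rw [e0]
    nth_rw 1 [← Real.exp_log hA]
    rw [← Real.exp_add, hs]
    ring_nf
  have e2 : Real.exp ((1 - θ) * s) * (b + δ) = (a + δ) ^ (1 - θ) * (b + δ) ^ θ := by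
    rw [e0]
    nth_rw 1 [← Real.exp_log hB]
    rw [← Real.exp_add, hs]
    ring_nf
  obtain ⟨h1, h2, h3⟩ := h.shift s
  refine ⟨_, _, h1, h2.trans_lt ?_, h3.trans_lt ?_⟩
  · refine lt_of_le_of_lt ?_ (e1.trans_lt hδc)
    gcongr
    linarith
  · refine lt_of_le_of_lt ?_ (e2.trans_lt hδc)
    gcongr
    linarith

end InterpNorm

section InterpNorm

variable {A₀ A₁ : Type*} [NormedAddCommGroup A₀] [NormedSpace ℝ A₀]
  [NormedAddCommGroup A₁] [NormedSpace ℝ A₁] {ι : A₀ →L[ℝ] A₁} {θ p : ℝ}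

lemma IsInterpRep.zero : IsInterpRep ι θ p 0 (fun _ => 0) (fun _ => 0) :=
  ⟨by simp, by simp, by simp⟩

lemma IsInterpRep.add {z w : A₁} {x₁ y₁ : ℝ → A₀} {x₂ y₂ : ℝ → A₁}
    (h : IsInterpRep ι θ p z x₁ x₂) (h' : IsInterpRep ι θ p w y₁ y₂) :
    IsInterpRep ι θ p (z + w) (fun t => x₁ t + y₁ t) (fun t => x₂ t + y₂ t) where
  eq_add t := by rw [h.eq_add t, h'.eq_add t, map_add]; abel
  memLp₁ := by simp only [smul_add]; exact h.memLp₁.add h'.memLp₁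
  memLp₂ := by simp only [smul_add]; exact h.memLp₂.add h'.memLp₂

lemma IsInterpRep.smul {z : A₁} {x₁ : ℝ → A₀} {x₂ : ℝ → A₁}
    (h : IsInterpRep ι θ p z x₁ x₂) (c : ℝ) :
    IsInterpRep ι θ p (c • z) (fun t => c • x₁ t) (fun t => c • x₂ t) where
  eq_add t := by rw [h.eq_add t, map_smul, smul_add]
  memLp₁ := by simpa only [smul_comm _ c, Pi.smul_def] using h.memLp₁.const_smul c
  memLp₂ := by simpa only [smul_comm _ c, Pi.smul_def] using h.memLp₂.const_smul c

/-- The vector space `[A₀, A₁]_{θ,p}`. -/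
def interpSubmodule (ι : A₀ →L[ℝ] A₁) (θ p : ℝ) : Submodule ℝ A₁ where
  carrier := interpSet ι θ p
  zero_mem' := ⟨_, _, IsInterpRep.zero⟩
  add_mem' := by
    rintro z w ⟨_, _, h⟩ ⟨_, _, h'⟩
    exact ⟨_, _, h.add h'⟩
  smul_mem' := by
    rintro c z ⟨_, _, h⟩
    exact ⟨_, _, h.smul c⟩

/-- The product formula is not visibly subadditive. For balanced representations it can be replaced
by a maximum of two L_p norms, to which Minkowski's inequality applies. -/
lemma interpNorm_add_le (hθ₀ : 0 < θ) (hθ₁ : θ < 1) (hp : 1 < p) {z w : A₁}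
    (hz : z ∈ interpSet ι θ p) (hw : w ∈ interpSet ι θ p) :
    interpNorm ι θ p (z + w) ≤ interpNorm ι θ p z + interpNorm ι θ p w := by
  refine le_of_forall_pos_lt_add fun ε hε => ?_
  obtain ⟨x₁, x₂, h, h₁, h₂⟩ := exists_rep_of_interpNorm_lt hθ₀ hθ₁ hz
    (lt_add_of_pos_right _ (show 0 < ε / 4 by positivity))
  obtain ⟨y₁, y₂, h', h₁', h₂'⟩ := exists_rep_of_interpNorm_lt hθ₀ hθ₁ hw
    (lt_add_of_pos_right _ (show 0 < ε / 4 by positivity))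
  have h1p : 1 ≤ ENNReal.ofReal p := by simpa using hp.le
  have := interpNorm_le_of_rep hθ₀ hθ₁ (h.add h')
    (c := interpNorm ι θ p z + interpNorm ι θ p w + ε / 2) ?_ ?_
  · linarith
  · simp only [smul_add]
    have := ENNReal.toReal_mono (ENNReal.add_ne_top.2 ⟨h.memLp₁.2.ne, h'.memLp₁.2.ne⟩)
      (eLpNorm_add_le h.memLp₁.1 h'.memLp₁.1 h1p)
    rw [ENNReal.toReal_add h.memLp₁.2.ne h'.memLp₁.2.ne] at this
    exact this.trans (by linarith)
  · simp only [smul_add]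
    have := ENNReal.toReal_mono (ENNReal.add_ne_top.2 ⟨h.memLp₂.2.ne, h'.memLp₂.2.ne⟩)
      (eLpNorm_add_le h.memLp₂.1 h'.memLp₂.1 h1p)
    rw [ENNReal.toReal_add h.memLp₂.2.ne h'.memLp₂.2.ne] at this
    exact this.trans (by linarith)

lemma interpNorm_smul_le (hθ₀ : 0 < θ) (hθ₁ : θ < 1) {z : A₁}
    (hz : z ∈ interpSet ι θ p) (c : ℝ) :
    interpNorm ι θ p (c • z) ≤ |c| * interpNorm ι θ p z := by
  refine le_of_forall_pos_le_add fun ε hε => ?_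
  have hc : 0 < |c| + 1 := by positivity
  obtain ⟨x₁, x₂, h, h₁, h₂⟩ := exists_rep_of_interpNorm_lt hθ₀ hθ₁ hz
    (lt_add_of_pos_right _ (show 0 < ε / (|c| + 1) by positivity))
  have hle : |c| * (interpNorm ι θ p z + ε / (|c| + 1)) ≤ |c| * interpNorm ι θ p z + ε := by
    rw [mul_add]
    gcongr
    rw [mul_div_assoc', div_le_iff₀ hc]
    nlinarith [abs_nonneg c]
  refine interpNorm_le_of_rep hθ₀ hθ₁ (h.smul c) ?_ ?_
  · simp only [smul_comm _ c]
    have := ENNReal.toReal_mono (ENNReal.mul_ne_top enorm_ne_top h.memLp₁.2.ne)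
      (eLpNorm_const_smul_le (c := c))
    rw [ENNReal.toReal_mul, toReal_enorm, Real.norm_eq_abs] at this
    exact this.trans (le_trans (by gcongr) hle)
  · simp only [smul_comm _ c]
    have := ENNReal.toReal_mono (ENNReal.mul_ne_top enorm_ne_top h.memLp₂.2.ne)
      (eLpNorm_const_smul_le (c := c))
    rw [ENNReal.toReal_mul, toReal_enorm, Real.norm_eq_abs] at this
    exact this.trans (le_trans (by gcongr) hle)

/-- One half of the equivalence of norms; the constants 1 and e are those of `interpDisc_le_of_rep`
for a balanced representation. The other half is `interpNorm_le_interpDisc`. -/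
lemma interpDisc_le_interpNorm (hθ₀ : 0 < θ) (hθ₁ : θ < 1) (hp : 1 < p) {z : A₁}
    (hz : z ∈ interpSet ι θ p) :
    interpDisc ι θ p z ≤ ENNReal.ofReal ((1 + Real.exp 1) * interpNorm ι θ p z) := by
  have key : ∀ ε > 0, interpDisc ι θ p z ≤
      ENNReal.ofReal ((1 + Real.exp 1) * (interpNorm ι θ p z + ε)) := by
    intro ε hε
    obtain ⟨x₁, x₂, h, h₁, h₂⟩ := exists_rep_of_interpNorm_lt hθ₀ hθ₁ hz
      (lt_add_of_pos_right _ hε)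
    refine (interpDisc_le_of_rep hθ₀ hp h).trans ?_
    have hN : 0 ≤ interpNorm ι θ p z + ε := by
      have := interpNorm_nonneg (ι := ι) (θ := θ) (p := p) z
      positivity
    rw [add_mul, one_mul, ENNReal.ofReal_add hN (by positivity), ENNReal.ofReal_mul (by positivity)]
    gcongr
    · rw [← ENNReal.ofReal_toReal h.memLp₁.2.ne]
      exact ENNReal.ofReal_le_ofReal h₁.le
    · rw [← ENNReal.ofReal_toReal h.memLp₂.2.ne]
      exact ENNReal.ofReal_le_ofReal h₂.le
  have hcont : Continuous fun ε : ℝ =>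
      ENNReal.ofReal ((1 + Real.exp 1) * (interpNorm ι θ p z + ε)) :=
    ENNReal.continuous_ofReal.comp (by fun_prop)
  have hlim := (hcont.tendsto 0).mono_left (nhdsWithin_le_nhds (s := Ioi 0))
  rw [add_zero] at hlim
  exact ge_of_tendsto hlim (mem_of_superset self_mem_nhdsWithin key)

lemma interpNorm_le_interpDisc (hθ₀ : 0 < θ) (hθ₁ : θ < 1) {z : A₁}
    (h : interpDisc ι θ p z ≠ ⊤) :
    z ∈ interpSet ι θ p ∧
      interpNorm ι θ p z ≤ 2 * Real.exp 1 * (interpDisc ι θ p z).toReal := by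
  obtain ⟨x₁, x₂, hr, h₁, h₂⟩ := exists_rep_of_interpDisc hθ₀ hθ₁ h
  have htop := ENNReal.mul_ne_top (ENNReal.ofReal_ne_top (r := 2 * Real.exp 1)) h
  have e : (ENNReal.ofReal (2 * Real.exp 1) * interpDisc ι θ p z).toReal =
      2 * Real.exp 1 * (interpDisc ι θ p z).toReal := by
    rw [ENNReal.toReal_mul, ENNReal.toReal_ofReal (by positivity)]
  refine ⟨⟨x₁, x₂, hr⟩, interpNorm_le_of_rep hθ₀ hθ₁ hr ?_ ?_⟩
  · exact (ENNReal.toReal_mono htop h₁).trans_eq e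
  · exact (ENNReal.toReal_mono htop h₂).trans_eq e

lemma interpK_le_interpNorm (hθ₀ : 0 < θ) (hθ₁ : θ < 1) (hp : 1 < p) {z : A₁}
    (hz : z ∈ interpSet ι θ p) (n : ℤ) :
    interpK ι θ n z ≤ (1 + Real.exp 1) * interpNorm ι θ p z := by
  have h0 := interpNorm_nonneg (ι := ι) (θ := θ) (p := p) z
  exact (ENNReal.ofReal_le_ofReal_iff (by positivity)).1
    ((interpK_le_interpDisc hp n z).trans (interpDisc_le_interpNorm hθ₀ hθ₁ hp hz))

/-- A type synonym for `interpSubmodule`, to carry the norm of `[A₀, A₁]_{θ,p}`. -/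
def InterpSpace {A₀ A₁ : Type*} [NormedAddCommGroup A₀] [NormedSpace ℝ A₀]
    [NormedAddCommGroup A₁] [NormedSpace ℝ A₁] (ι : A₀ →L[ℝ] A₁) (θ p : ℝ) : Type _ :=
  interpSubmodule ι θ p

instance : AddCommGroup (InterpSpace ι θ p) :=
  inferInstanceAs (AddCommGroup (interpSubmodule ι θ p))

noncomputable instance : Module ℝ (InterpSpace ι θ p) :=
  inferInstanceAs (Module ℝ (interpSubmodule ι θ p))

/-- The inclusion of `[A₀, A₁]_{θ,p}` in `A₁`. -/
noncomputable def InterpSpace.incl (ι : A₀ →L[ℝ] A₁) (θ p : ℝ) : InterpSpace ι θ p →ₗ[ℝ] A₁ :=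
  (interpSubmodule ι θ p).subtype

lemma InterpSpace.incl_injective : Function.Injective (InterpSpace.incl ι θ p) :=
  Subtype.val_injective

lemma InterpSpace.incl_mem (z : InterpSpace ι θ p) : InterpSpace.incl ι θ p z ∈ interpSet ι θ p :=
  z.2

noncomputable instance : Norm (InterpSpace ι θ p) :=
  ⟨fun z => interpNorm ι θ p (InterpSpace.incl ι θ p z)⟩

lemma InterpSpace.core (hθ₀ : 0 < θ) (hθ₁ : θ < 1) (hp : 1 < p) :
    NormedSpace.Core ℝ (InterpSpace ι θ p) where
  norm_nonneg z := interpNorm_nonneg _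
  norm_smul c z := by
    have hle : ∀ (c : ℝ) (z : InterpSpace ι θ p), ‖c • z‖ ≤ |c| * ‖z‖ := fun c z => by
      have := interpNorm_smul_le hθ₀ hθ₁ z.incl_mem c
      rwa [← map_smul] at this
    refine le_antisymm (hle c z) ?_
    rcases eq_or_ne c 0 with rfl | hc
    · rw [norm_zero, zero_mul]
      exact interpNorm_nonneg _
    · have := hle c⁻¹ (c • z)
      rw [smul_smul, inv_mul_cancel₀ hc, one_smul, abs_inv, ← div_eq_inv_mul,
        le_div_iff₀ (abs_pos.2 hc)] at this
      rw [Real.norm_eq_abs]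
      linarith
  norm_triangle z w := by
    have := interpNorm_add_le hθ₀ hθ₁ hp z.incl_mem w.incl_mem
    rwa [← map_add] at this
  norm_eq_zero_iff z := by
    constructor
    · intro h
      -- Definiteness: a null vector has K-functional zero at time 0, where it is already a norm.
      have h1 := interpK_le_interpNorm hθ₀ hθ₁ hp z.incl_mem 0
      change interpNorm ι θ p (InterpSpace.incl ι θ p z) = 0 at h
      rw [h, mul_zero] at h1
      by_contra hz
      have : InterpSpace.incl ι θ p z ≠ 0 := fun h0 =>
        hz (InterpSpace.incl_injective (by simpa using h0))
      exact absurd (interpK_pos ι θ ((0 : ℤ) : ℝ) this) (not_lt.2 h1)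
    · rintro rfl
      refine le_antisymm ?_ (interpNorm_nonneg _)
      have := interpNorm_smul_le (p := p) hθ₀ hθ₁ (InterpSpace.incl_mem (0 : InterpSpace ι θ p)) 0
      rw [abs_zero, zero_mul, zero_smul] at this
      change interpNorm ι θ p (InterpSpace.incl ι θ p 0) ≤ 0
      rwa [map_zero]

end InterpNorm

lemma exists_isInterpolationSpace {A₀ A₁ : Type u} [NormedAddCommGroup A₀] [NormedSpace ℝ A₀]
    [NormedAddCommGroup A₁] [NormedSpace ℝ A₁] (ι : A₀ →L[ℝ] A₁) {θ p : ℝ}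
    (hθ₀ : 0 < θ) (hθ₁ : θ < 1) (hp : 1 < p) :
    ∃ (R : Type u) (_ : NormedAddCommGroup R) (_ : NormedSpace ℝ R) (j : R →ₗ[ℝ] A₁),
      IsInterpolationSpace ι θ p j := by
  have core := InterpSpace.core (ι := ι) hθ₀ hθ₁ hp
  let i₁ : NormedAddCommGroup (InterpSpace ι θ p) := NormedAddCommGroup.ofCore core
  let i₂ : NormedSpace ℝ (InterpSpace ι θ p) := NormedSpace.ofCore core
  exact ⟨InterpSpace ι θ p, i₁, i₂, InterpSpace.incl ι θ p,
    InterpSpace.incl_injective, Subtype.range_val, fun r => rfl⟩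

/-! ### Semicontinuity and disjointness estimates for the discrete norm -/

section Discrete

variable {A₀ A₁ : Type*} [NormedAddCommGroup A₀] [NormedSpace ℝ A₀]
  [NormedAddCommGroup A₁] [NormedSpace ℝ A₁] {ι : A₀ →L[ℝ] A₁} {θ p : ℝ}

lemma aestronglyMeasurable_count (f : ℤ → ℝ) : AEStronglyMeasurable f Measure.count :=
  StronglyMeasurable.of_discrete.aestronglyMeasurable

lemma interpDisc_add_le (hp : 1 < p) (z w : A₁) :
    interpDisc ι θ p (z + w) ≤ interpDisc ι θ p z + interpDisc ι θ p w := by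
  refine (eLpNorm_mono_real (g := (fun n : ℤ => interpK ι θ n z) + fun n : ℤ => interpK ι θ n w)
    fun n => ?_).trans (eLpNorm_add_le (aestronglyMeasurable_count _)
      (aestronglyMeasurable_count _) (by simpa using hp.le))
  rw [Real.norm_of_nonneg (apply_nonneg _ _)]
  exact map_add_le_add _ _ _

lemma interpDisc_smul_le (c : ℝ) (z : A₁) :
    interpDisc ι θ p (c • z) ≤ ENNReal.ofReal |c| * interpDisc ι θ p z := by
  have : (fun n : ℤ => interpK ι θ n (c • z)) = |c| • fun n : ℤ => interpK ι θ n z := by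
    ext n
    simp [map_smul_eq_mul]
  rw [interpDisc, this]
  refine eLpNorm_const_smul_le.trans_eq ?_
  rw [Real.enorm_of_nonneg (abs_nonneg c), interpDisc]

/-- Together with `isClosed_interpDisc_le` this makes discrete balls closed under weak limits in A₁.
-/
lemma convex_interpDisc_le (hp : 1 < p) (C : ℝ≥0∞) :
    Convex ℝ {z : A₁ | interpDisc ι θ p z ≤ C} := by
  intro z hz w hw a b ha hb hab
  refine (interpDisc_add_le hp _ _).trans ((add_le_add (interpDisc_smul_le a z)
    (interpDisc_smul_le b w)).trans ?_)
  rw [abs_of_nonneg ha, abs_of_nonneg hb]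
  calc _ ≤ ENNReal.ofReal a * C + ENNReal.ofReal b * C := by gcongr <;> assumption
    _ = C := by rw [← add_mul, ← ENNReal.ofReal_add ha hb, hab, ENNReal.ofReal_one, one_mul]

lemma abs_interpK_sub_le (t : ℝ) (z w : A₁) :
    |interpK ι θ t z - interpK ι θ t w| ≤ Real.exp (-(1 - θ) * t) * ‖z - w‖ :=
  (abs_sub_map_le_sub _ _ _).trans (interpK_le_norm ι θ t _)

lemma continuous_interpK (t : ℝ) : Continuous (interpK ι θ t) := by
  refine (LipschitzWith.of_dist_le_mul (K := ⟨Real.exp (-(1 - θ) * t), (Real.exp_pos _).le⟩)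
    fun z w => ?_).continuous
  rw [Real.dist_eq, dist_eq_norm]
  exact abs_interpK_sub_le t z w

/-- Fatou's lemma, as each term of the ℓ_p norm is continuous on A₁. -/
lemma isClosed_interpDisc_le (C : ℝ≥0∞) : IsClosed {z : A₁ | interpDisc ι θ p z ≤ C} := by
  refine IsSeqClosed.isClosed fun w z hw hz => ?_
  refine (Lp.eLpNorm_lim_le_liminf_eLpNorm (f := fun (k : ℕ) (n : ℤ) => interpK ι θ n (w k))
    (fun k => aestronglyMeasurable_count _) (fun n : ℤ => interpK ι θ n z)
    (ae_of_all _ fun n => ((continuous_interpK (n : ℝ)).tendsto z).comp hz)).trans ?_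
  exact (liminf_le_liminf (Eventually.of_forall hw)).trans_eq (by simp)

/-- Finite counting measure means that `F` is finite, and on finitely many integers the K-functional
is bounded by a common multiple of the norm of A₁. -/
lemma tendsto_eLpNorm_indicator_interpK {α : Type*} {l : Filter α} {u : α → A₁}
    (hu : Tendsto (fun i => ‖u i‖) l (𝓝 0)) {F : Set ℤ} (hF : Measure.count F < ⊤) :
    Tendsto (fun i => eLpNorm (F.indicator fun n : ℤ => interpK ι θ n (u i))
      (ENNReal.ofReal p) Measure.count) l (𝓝 0) := by
  have hF' : F.Finite := Measure.count_apply_lt_top.1 hF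
  obtain ⟨C, hC⟩ := (hF'.image fun n : ℤ => Real.exp (-(1 - θ) * n)).bddAbove
  have hmem : MemLp (F.indicator fun _ : ℤ => C) (ENNReal.ofReal p) Measure.count :=
    memLp_indicator_const _ MeasurableSet.of_discrete _ (Or.inr hF.ne)
  have hle : ∀ i, eLpNorm (F.indicator fun n : ℤ => interpK ι θ n (u i))
      (ENNReal.ofReal p) Measure.count ≤ ENNReal.ofReal ‖u i‖ *
        eLpNorm (F.indicator fun _ : ℤ => C) (ENNReal.ofReal p) Measure.count := by
    intro i
    refine (eLpNorm_mono_real (g := ‖u i‖ • F.indicator fun _ : ℤ => C) fun n => ?_).trans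
      (eLpNorm_const_smul_le.trans_eq (by rw [Real.enorm_of_nonneg (norm_nonneg _)]))
    by_cases hn : n ∈ F
    · simp only [indicator_of_mem hn, Pi.smul_apply, smul_eq_mul]
      rw [Real.norm_of_nonneg (apply_nonneg _ _), mul_comm]
      exact (interpK_le_norm ι θ n _).trans (by gcongr; exact hC ⟨n, hn, rfl⟩)
    · simp [hn]
  have h0 : Tendsto (fun i => ENNReal.ofReal ‖u i‖ *
      eLpNorm (F.indicator fun _ : ℤ => C) (ENNReal.ofReal p) Measure.count) l (𝓝 0) := by
    have := ENNReal.Tendsto.mul_const (b := eLpNorm (F.indicator fun _ : ℤ => C)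
      (ENNReal.ofReal p) Measure.count) (ENNReal.tendsto_ofReal hu) (Or.inr hmem.2.ne)
    simpa using this
  exact tendsto_of_tendsto_of_tendsto_of_le_of_le tendsto_const_nhds h0 (fun _ => zero_le) hle

lemma exists_indicator_compl_interpK_lt {s : A₁} (hs : interpDisc ι θ p s ≠ ⊤) {η : ℝ≥0∞}
    (hη : η ≠ 0) : ∃ F : Set ℤ, Measure.count F < ⊤ ∧
      eLpNorm (Fᶜ.indicator fun n : ℤ => interpK ι θ n s) (ENNReal.ofReal p) Measure.count < η := by
  have hmem : MemLp (fun n : ℤ => interpK ι θ n s) (ENNReal.ofReal p) Measure.count :=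
    ⟨aestronglyMeasurable_count _, lt_top_iff_ne_top.2 hs⟩
  obtain ⟨F, -, hF, hlt⟩ := hmem.exists_eLpNorm_indicator_compl_lt ENNReal.ofReal_ne_top hη
  exact ⟨F, hF, hlt⟩

/-- A dominated convergence theorem for the discrete norm. -/
lemma tendsto_interpDisc_of_dominated (hp : 1 < p) {α : Type*} {l : Filter α} {u : α → A₁}
    (hu : Tendsto (fun i => ‖u i‖) l (𝓝 0)) {s : A₁} (hs : interpDisc ι θ p s ≠ ⊤)
    (hdom : ∀ i (n : ℤ), interpK ι θ n (u i) ≤ 2 * interpK ι θ n s) :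
    Tendsto (fun i => interpDisc ι θ p (u i)) l (𝓝 0) := by
  refine ENNReal.tendsto_nhds_zero.2 fun η hη => ?_
  -- The tail of `s` is counted twice because of the 2 in `hdom`, so a quarter of `η` leaves half
  -- for the finite part.
  obtain ⟨F, hF, hlt⟩ := exists_indicator_compl_interpK_lt hs
    (η := η / 4) (by simpa using hη.ne')
  have h1 := ENNReal.tendsto_nhds_zero.1
    (tendsto_eLpNorm_indicator_interpK (ι := ι) (θ := θ) (p := p) hu hF) (η / 2)
    (ENNReal.half_pos hη.ne')
  filter_upwards [h1] with i hi
  refine (eLpNorm_mono_real (g := (F.indicator fun n : ℤ => interpK ι θ n (u i)) +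
    (2 : ℝ) • Fᶜ.indicator fun n : ℤ => interpK ι θ n s) fun n => ?_).trans
    ((eLpNorm_add_le (aestronglyMeasurable_count _) (aestronglyMeasurable_count _)
      (by simpa using hp.le)).trans ?_)
  · rw [Real.norm_of_nonneg (apply_nonneg _ _)]
    by_cases hn : n ∈ F
    · simp [hn]
    · simpa [hn] using hdom i n
  · have h2 : eLpNorm ((2 : ℝ) • Fᶜ.indicator fun n : ℤ => interpK ι θ n s) (ENNReal.ofReal p)
        Measure.count ≤ 2 * (η / 4) := by
      refine eLpNorm_const_smul_le.trans ?_
      rw [Real.enorm_of_nonneg (by norm_num), ENNReal.ofReal_ofNat]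
      gcongr
    refine (add_le_add hi h2).trans_eq ?_
    rw [← mul_div_assoc, show (4 : ℝ≥0∞) = 2 * 2 by norm_num,
      ENNReal.mul_div_mul_left _ _ (by simp) (by simp), ENNReal.add_halves]

/-- The p-th powers of ℓ_p norms add on disjoint supports. -/
lemma eLpNorm_indicator_add_indicator_compl_le (hp : 1 < p) (F : Set ℤ) (a b : ℤ → ℝ) :
    eLpNorm (F.indicator a + Fᶜ.indicator b) (ENNReal.ofReal p) Measure.count ≤
      (eLpNorm a (ENNReal.ofReal p) Measure.count ^ p +
        eLpNorm b (ENNReal.ofReal p) Measure.count ^ p) ^ (1 / p) := by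
  have hp0 : 0 < p := by linarith
  have h0 : ENNReal.ofReal p ≠ 0 := by simpa using hp0
  have hr : (ENNReal.ofReal p).toReal = p := ENNReal.toReal_ofReal hp0.le
  have hpow : ∀ x : ℝ≥0∞, (x ^ (1 / p)) ^ p = x := fun x => by
    rw [← ENNReal.rpow_mul, one_div_mul_cancel hp0.ne', ENNReal.rpow_one]
  simp only [eLpNorm_eq_lintegral_rpow_enorm_toReal h0 ENNReal.ofReal_ne_top, hr, hpow]
  refine ENNReal.rpow_le_rpow ?_ (by positivity)
  have hF : MeasurableSet F := MeasurableSet.of_discrete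
  rw [← lintegral_add_compl _ hF]
  refine add_le_add ?_ ?_
  · refine le_trans (le_of_eq ?_) (setLIntegral_le_lintegral F _)
    exact setLIntegral_congr_fun hF fun n hn => by simp [hn]
  · refine le_trans (le_of_eq ?_) (setLIntegral_le_lintegral Fᶜ _)
    exact setLIntegral_congr_fun hF.compl fun n (hn : n ∉ F) => by simp [hn]

/-- The discrete norm is asymptotically `p`-subadditive along bounded sequences which converge to
zero in `A₁`. -/
lemma eventually_interpDisc_add_lt (hp : 1 < p) {α : Type*} {l : Filter α} {u : α → A₁}
    (hu : Tendsto (fun i => ‖u i‖) l (𝓝 0)) {M : ℝ≥0∞} (hM : ∀ i, interpDisc ι θ p (u i) ≤ M)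
    {s : A₁} (hs : interpDisc ι θ p s ≠ ⊤) {B : ℝ≥0∞}
    (hB : (interpDisc ι θ p s ^ p + M ^ p) ^ (1 / p) < B) :
    ∀ᶠ i in l, interpDisc ι θ p (s + u i) < B := by
  obtain ⟨η, hη, hηB⟩ := ENNReal.lt_iff_exists_add_pos_lt.1 hB
  have hη' : (η : ℝ≥0∞) / 2 ≠ 0 := by simpa using hη.ne'
  have h1p : 1 ≤ ENNReal.ofReal p := by simpa using hp.le
  obtain ⟨F, hF, hlt⟩ := exists_indicator_compl_interpK_lt hs hη'
  have h1 := ENNReal.tendsto_nhds_zero.1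
    (tendsto_eLpNorm_indicator_interpK (ι := ι) (θ := θ) (p := p) hu hF) _
    (pos_iff_ne_zero.2 hη')
  filter_upwards [h1] with i hi
  refine lt_of_le_of_lt ?_ hηB
  -- The main part, `s` on `F` and `u i` off `F`, has disjoint supports; the errors, `s` off `F` and
  -- `u i` on `F`, are each at most `η / 2`.
  refine (eLpNorm_mono_real (g := ((F.indicator fun n : ℤ => interpK ι θ n s) +
    Fᶜ.indicator fun n : ℤ => interpK ι θ n (u i)) +
    ((Fᶜ.indicator fun n : ℤ => interpK ι θ n s) +
    F.indicator fun n : ℤ => interpK ι θ n (u i))) fun n => ?_).trans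
    ((eLpNorm_add_le (aestronglyMeasurable_count _) (aestronglyMeasurable_count _) h1p).trans
      (add_le_add ?_ ((eLpNorm_add_le (aestronglyMeasurable_count _)
        (aestronglyMeasurable_count _) h1p).trans ?_)))
  · rw [Real.norm_of_nonneg (apply_nonneg _ _)]
    have := map_add_le_add (interpK ι θ n) s (u i)
    by_cases hn : n ∈ F
    · simpa [hn] using this
    · simpa [hn, add_comm] using this
  · refine (eLpNorm_indicator_add_indicator_compl_le hp F _ _).trans ?_
    refine ENNReal.rpow_le_rpow ?_ (by positivity)
    gcongr
    · exact le_rfl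
    · exact hM i
  · exact (add_le_add hlt.le hi).trans_eq (ENNReal.add_halves _)

end Discrete

/-! ### Reflexivity of the interpolation space and isometries of the couple -/

namespace IsInterpolationSpace

variable {A₀ A₁ R : Type*} [NormedAddCommGroup A₀] [NormedSpace ℝ A₀]
  [NormedAddCommGroup A₁] [NormedSpace ℝ A₁] [NormedAddCommGroup R] [NormedSpace ℝ R]
  {ι : A₀ →L[ℝ] A₁} {θ p : ℝ} {j : R →ₗ[ℝ] A₁}

lemma mem (h : IsInterpolationSpace ι θ p j) (r : R) : j r ∈ interpSet ι θ p :=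
  h.range_eq ▸ mem_range_self r

lemma interpDisc_le (h : IsInterpolationSpace ι θ p j) (hθ₀ : 0 < θ) (hθ₁ : θ < 1) (hp : 1 < p)
    (r : R) : interpDisc ι θ p (j r) ≤ ENNReal.ofReal ((1 + Real.exp 1) * ‖r‖) :=
  h.norm_eq r ▸ interpDisc_le_interpNorm hθ₀ hθ₁ hp (h.mem r)

lemma interpDisc_ne_top (h : IsInterpolationSpace ι θ p j) (hθ₀ : 0 < θ) (hθ₁ : θ < 1)
    (hp : 1 < p) (r : R) : interpDisc ι θ p (j r) ≠ ⊤ :=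
  ((h.interpDisc_le hθ₀ hθ₁ hp r).trans_lt ENNReal.ofReal_lt_top).ne

lemma norm_le (h : IsInterpolationSpace ι θ p j) (hθ₀ : 0 < θ) (hθ₁ : θ < 1) (hp : 1 < p)
    (r : R) : ‖r‖ ≤ 2 * Real.exp 1 * (interpDisc ι θ p (j r)).toReal :=
  h.norm_eq r ▸ (interpNorm_le_interpDisc hθ₀ hθ₁ (h.interpDisc_ne_top hθ₀ hθ₁ hp r)).2

lemma exists_eq (h : IsInterpolationSpace ι θ p j) (hθ₀ : 0 < θ) (hθ₁ : θ < 1) {z : A₁}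
    (hz : interpDisc ι θ p z ≠ ⊤) : ∃ r, j r = z := by
  have := (interpNorm_le_interpDisc hθ₀ hθ₁ hz).1
  rwa [← h.range_eq] at this

lemma interpK_le (h : IsInterpolationSpace ι θ p j) (hθ₀ : 0 < θ) (hθ₁ : θ < 1) (hp : 1 < p)
    (n : ℤ) (r : R) : interpK ι θ n (j r) ≤ (1 + Real.exp 1) * ‖r‖ :=
  h.norm_eq r ▸ interpK_le_interpNorm hθ₀ hθ₁ hp (h.mem r) n

lemma exists_continuousLinearMap (h : IsInterpolationSpace ι θ p j) (hθ₀ : 0 < θ) (hθ₁ : θ < 1)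
    (hp : 1 < p) : ∃ J : R →L[ℝ] A₁, ∀ r, J r = j r := by
  refine ⟨j.mkContinuous ((‖ι‖ + 1) * (1 + Real.exp 1)) fun r => ?_, fun r => rfl⟩
  have h1 := norm_le_interpK ι θ ((0 : ℤ) : ℝ) (j r)
  simp only [Int.cast_zero, mul_zero, neg_zero, Real.exp_zero, mul_one] at h1
  refine h1.trans ?_
  rw [mul_assoc]
  gcongr
  simpa using h.interpK_le hθ₀ hθ₁ hp 0 r

/-- As n → -∞ the weight on A₁ blows up, so a bound on the K-functional forces the A₁ part to be
small, at the price of a large but uniform bound in A₀. -/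
lemma exists_decomp_norm_le (h : IsInterpolationSpace ι θ p j) (hθ₀ : 0 < θ) (hθ₁ : θ < 1)
    (hp : 1 < p) (M : ℝ) {ε : ℝ} (hε : 0 < ε) :
    ∃ C > 0, ∀ r, ‖r‖ ≤ M → ∃ x y, j r = ι x + y ∧ ‖x‖ ≤ C ∧ ‖y‖ ≤ ε := by
  set C := (1 + Real.exp 1) * |M| + 1 with hC
  have hCpos : 0 < C := by positivity
  obtain ⟨n, hn⟩ : ∃ n : ℤ, Real.exp ((1 - θ) * n) * C ≤ ε := by
    refine ⟨⌊Real.log (ε / C) / (1 - θ)⌋, ?_⟩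
    rw [← le_div_iff₀ hCpos, ← Real.le_log_iff_exp_le (by positivity), mul_comm,
      ← le_div_iff₀ (by linarith)]
    exact Int.floor_le _
  refine ⟨Real.exp (-(θ * n)) * C, by positivity, fun r hr => ?_⟩
  have hk : interpK ι θ n (j r) < C := by
    refine (h.interpK_le hθ₀ hθ₁ hp n r).trans_lt ?_
    have : (1 + Real.exp 1) * ‖r‖ ≤ (1 + Real.exp 1) * |M| := by
      gcongr
      exact hr.trans (le_abs_self M)
    linarith
  obtain ⟨x, y, hxy, hlt⟩ := exists_decomp_of_interpK_lt ι θ n hk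
  have hx0 : 0 ≤ Real.exp (θ * n) * ‖x‖ := by positivity
  have hy0 : 0 ≤ Real.exp (-(1 - θ) * n) * ‖y‖ := by positivity
  refine ⟨x, y, hxy, ?_, le_trans ?_ hn⟩
  · calc ‖x‖ = Real.exp (-(θ * n)) * (Real.exp (θ * n) * ‖x‖) := by
          rw [← mul_assoc, ← Real.exp_add, neg_add_cancel, Real.exp_zero, one_mul]
      _ ≤ _ := by gcongr; linarith
  · calc ‖y‖ = Real.exp ((1 - θ) * n) * (Real.exp (-(1 - θ) * n) * ‖y‖) := by
          rw [← mul_assoc, ← Real.exp_add, neg_mul, add_neg_cancel, Real.exp_zero, one_mul]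
      _ ≤ _ := by gcongr; linarith

/-- If `ι` is weakly compact, then balls of the interpolation space are relatively weakly compact
in `A₁`. -/
lemma isRelWeaklyCompact_image [CompleteSpace A₁] (h : IsInterpolationSpace ι θ p j) (hθ₀ : 0 < θ)
    (hθ₁ : θ < 1) (hp : 1 < p) (hι : IsRelWeaklyCompact (ι '' Metric.closedBall 0 1)) (M : ℝ) :
    IsRelWeaklyCompact (j '' Metric.closedBall 0 M) := by
  refine IsRelWeaklyCompact.of_approx fun ε hε => ?_
  obtain ⟨c, hcpos, hc⟩ := h.exists_decomp_norm_le hθ₀ hθ₁ hp M hε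
  refine ⟨_, hι.smul c, ?_⟩
  rintro _ ⟨r, hr, rfl⟩
  obtain ⟨x, y, hxy, hx, hy⟩ := hc r (by simpa using hr)
  refine ⟨ι x, ⟨ι (c⁻¹ • x), ⟨c⁻¹ • x, ?_, rfl⟩, ?_⟩, ?_⟩
  · rw [mem_closedBall_zero_iff, norm_smul, norm_inv, Real.norm_of_nonneg hcpos.le,
      inv_mul_le_iff₀ hcpos, mul_one]
    exact hx
  · rw [map_smul, smul_smul, mul_inv_cancel₀ hcpos.ne', one_smul]
  · rwa [hxy, add_sub_cancel_left]

/-- On bounded sets, functionals on the interpolation space are small where the norm of `A₁` is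
small. -/
lemma exists_apply_lt (h : IsInterpolationSpace ι θ p j) (hθ₀ : 0 < θ) (hθ₁ : θ < 1)
    (hp : 1 < p) (φ : StrongDual ℝ R) (M : ℝ) {ε : ℝ} (hε : 0 < ε) :
    ∃ δ > 0, ∀ r, ‖r‖ ≤ M → ‖j r‖ < δ → φ r < ε := by
  by_contra! hcon
  have hp0 : 0 < p := by linarith
  have : ∀ k : ℕ, ∃ r, ‖r‖ ≤ M ∧ ‖j r‖ < 1 / ((k : ℝ) + 1) ∧ ε ≤ φ r := fun k =>
    hcon _ Nat.one_div_pos_of_nat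
  choose u huM hu0 huφ using this
  have hu : Tendsto (fun k => ‖j (u k)‖) atTop (𝓝 0) :=
    squeeze_zero (fun _ => norm_nonneg _) (fun k => (hu0 k).le)
      tendsto_one_div_add_atTop_nhds_zero_nat
  set M' : ℝ := (1 + Real.exp 1) * |M| with hM'
  have hM0 : 0 ≤ M' := by positivity
  have huD : ∀ k, interpDisc ι θ p (j (u k)) ≤ ENNReal.ofReal M' := fun k =>
    (h.interpDisc_le hθ₀ hθ₁ hp (u k)).trans (ENNReal.ofReal_le_ofReal
      (mul_le_mul_of_nonneg_left ((huM k).trans (le_abs_self M)) (by positivity)))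
  -- The extra 1 provides the strict inequality needed each time a term is added.
  set L : ℝ := M' ^ p + 1 with hL
  have hL0 : 0 < L := by positivity
  -- Gliding hump: each new term is chosen so far out that it is almost disjoint from the sum so
  -- far. The norm then grows like m^{1/p} while `φ` grows like m, which is impossible as p > 1.
  have hsum : ∀ m : ℕ, ∃ s : R, m * ε ≤ φ s ∧
      interpDisc ι θ p (j s) ≤ ENNReal.ofReal ((m * L) ^ (1 / p)) := by
    intro m
    induction m with
    | zero => exact ⟨0, by simp, by simp [interpDisc]⟩
    | succ m ih =>
      obtain ⟨s, hsφ, hsD⟩ := ih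
      have hB : (interpDisc ι θ p (j s) ^ p + ENNReal.ofReal M' ^ p) ^ (1 / p) <
          ENNReal.ofReal (((m + 1 : ℕ) * L) ^ (1 / p)) := by
        have h1 : interpDisc ι θ p (j s) ^ p ≤ ENNReal.ofReal (m * L) := by
          refine (ENNReal.rpow_le_rpow hsD hp0.le).trans_eq ?_
          rw [ENNReal.ofReal_rpow_of_nonneg (by positivity) hp0.le,
            ← Real.rpow_mul (by positivity), one_div_mul_cancel hp0.ne', Real.rpow_one]
        rw [← ENNReal.ofReal_rpow_of_nonneg (by positivity) (by positivity)]
        refine ENNReal.rpow_lt_rpow ?_ (by positivity)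
        rw [ENNReal.ofReal_rpow_of_nonneg hM0 hp0.le]
        refine (add_le_add_left h1 _).trans_lt ?_
        rw [← ENNReal.ofReal_add (by positivity) (by positivity)]
        refine (ENNReal.ofReal_lt_ofReal_iff (by positivity)).2 ?_
        push_cast
        linarith
      obtain ⟨k, hk⟩ := (eventually_interpDisc_add_lt hp hu huD
        (h.interpDisc_ne_top hθ₀ hθ₁ hp s) hB).exists
      refine ⟨s + u k, ?_, ?_⟩
      · rw [map_add]
        push_cast
        linarith [huφ k]
      · rw [map_add]
        exact hk.le
  set C := ‖φ‖ * (2 * Real.exp 1 * L ^ (1 / p)) with hC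
  have hbound : ∀ m : ℕ, 1 ≤ m → (m : ℝ) ^ (1 - 1 / p) ≤ C / ε := by
    intro m hm
    have hm0 : (0 : ℝ) < m := by exact_mod_cast hm
    obtain ⟨s, hsφ, hsD⟩ := hsum m
    have h1 : (interpDisc ι θ p (j s)).toReal ≤ (m * L) ^ (1 / p) :=
      ENNReal.toReal_le_of_le_ofReal (by positivity) hsD
    have h2 : φ s ≤ ‖φ‖ * (2 * Real.exp 1 * (m * L) ^ (1 / p)) :=
      (le_abs_self _).trans ((φ.le_opNorm s).trans (by
        gcongr
        exact (h.norm_le hθ₀ hθ₁ hp s).trans (by gcongr)))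
    rw [Real.rpow_sub hm0, Real.rpow_one, div_le_div_iff₀ (by positivity) hε]
    refine hsφ.trans (h2.trans_eq ?_)
    rw [Real.mul_rpow hm0.le hL0.le, hC]
    ring
  have hexp : 0 < 1 - 1 / p := by
    rw [sub_pos, div_lt_one hp0]
    exact hp
  have hlim := (tendsto_rpow_atTop hexp).comp (tendsto_natCast_atTop_atTop (R := ℝ))
  obtain ⟨m, hm, hm1⟩ := ((hlim.eventually_gt_atTop (C / ε)).and (eventually_ge_atTop 1)).exists
  exact absurd (hbound m hm1) (not_le.2 hm)

/-- Mazur's trick: bounded elements with `φ ≥ a / 2` form a convex set whose image has 0 in its weak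
closure, hence in its norm closure, against `exists_apply_lt`. Used for both `φ` and `-φ`, it shows
that weak nullity in A₁ implies weak nullity in R. -/
lemma tendsto_of_weak_tendsto (h : IsInterpolationSpace ι θ p j) (hθ₀ : 0 < θ) (hθ₁ : θ < 1)
    (hp : 1 < p) {α : Type*} {l : Filter α} [l.NeBot] {r : α → R} {M : ℝ}
    (hM : ∀ᶠ i in l, ‖r i‖ ≤ M)
    (hr : ∀ ψ : StrongDual ℝ A₁, Tendsto (fun i => ψ (j (r i))) l (𝓝 0)) (φ : StrongDual ℝ R)
    {a : ℝ} (ha : Tendsto (fun i => φ (r i)) l (𝓝 a)) : a ≤ 0 := by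
  by_contra! hapos
  let C : Set R := {s | ‖s‖ ≤ M ∧ a / 2 ≤ φ s}
  have hC : Convex ℝ C := by
    have h1 : Convex ℝ {s : R | ‖s‖ ≤ M} := by
      simpa [Metric.closedBall] using convex_closedBall (0 : R) M
    exact h1.inter (convex_halfSpace_ge φ.toLinearMap.isLinear _)
  have hmem : (0 : A₁) ∈ closure (j '' C) := by
    refine (hC.linear_image j).closure.mem_of_weak_tendsto (l := l) isClosed_closure
      (w := fun i => j (r i)) (fun ψ => by simpa using hr ψ) ?_
    filter_upwards [hM, ha.eventually_const_le (half_lt_self hapos)] with i h1 h2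
    exact subset_closure ⟨r i, ⟨h1, h2⟩, rfl⟩
  obtain ⟨δ, hδ, hlt⟩ := h.exists_apply_lt hθ₀ hθ₁ hp φ M (half_pos hapos)
  obtain ⟨_, ⟨s, hs, rfl⟩, hsδ⟩ := Metric.mem_closure_iff.1 hmem δ hδ
  rw [dist_zero_left] at hsδ
  exact absurd (hlt s hs.1 hsδ) (not_lt.2 hs.2)

/-- The interpolation space of a weakly compact inclusion is reflexive. -/
theorem isReflexiveSpace [CompleteSpace A₁] (h : IsInterpolationSpace ι θ p j) (hθ₀ : 0 < θ)
    (hθ₁ : θ < 1) (hp : 1 < p) (hι : IsRelWeaklyCompact (ι '' Metric.closedBall 0 1)) :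
    IsReflexiveSpace R := by
  intro Ξ
  obtain ⟨J, hJ⟩ := h.exists_continuousLinearMap hθ₀ hθ₁ hp
  obtain ⟨U, hUM, hU⟩ := exists_ultrafilter_tendsto_bidual Ξ
  set M := ‖Ξ‖ + 1 with hM
  obtain ⟨z, hz⟩ := (h.isRelWeaklyCompact_image hθ₀ hθ₁ hp hι M).exists_tendsto U (w := j)
    (hUM.mono fun r hr => ⟨r, by simpa using hr, rfl⟩)
  -- The weak limit in A₁ remains in a discrete ball, hence comes from an element of R.
  have hdisc : interpDisc ι θ p z ≤ ENNReal.ofReal ((1 + Real.exp 1) * M) := by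
    refine (convex_interpDisc_le hp _).mem_of_weak_tendsto (isClosed_interpDisc_le _) hz ?_
    filter_upwards [hUM] with r hr
    exact (h.interpDisc_le hθ₀ hθ₁ hp r).trans (ENNReal.ofReal_le_ofReal (by gcongr))
  obtain ⟨r, rfl⟩ := h.exists_eq hθ₀ hθ₁ (hdisc.trans_lt ENNReal.ofReal_lt_top).ne
  have hle : ∀ φ : StrongDual ℝ R, Ξ φ - φ r ≤ 0 := fun φ => by
    refine h.tendsto_of_weak_tendsto hθ₀ hθ₁ hp (l := (U : Filter R)) (r := fun s => s - r)
      (M := M + ‖r‖) ?_ (fun ψ => ?_) φ ?_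
    · filter_upwards [hUM] with s hs
      exact (norm_sub_le _ _).trans (by gcongr)
    · simpa using (hz ψ).sub_const (ψ (j r))
    · simpa using (hU φ).sub_const (φ r)
  refine ⟨r, ?_⟩
  ext φ
  have h1 := hle φ
  have h2 := hle (-φ)
  simp only [map_neg, neg_apply] at h2
  rw [NormedSpace.dual_def]
  linarith

lemma interpK_map_equiv_le (S₀ : A₀ ≃ₗᵢ[ℝ] A₀) (S₁ : A₁ ≃ₗᵢ[ℝ] A₁)
    (hS : ∀ x, ι (S₀ x) = S₁ (ι x)) (t : ℝ) (z : A₁) :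
    interpK ι θ t (S₁ z) ≤ interpK ι θ t z := by
  refine le_of_forall_gt_imp_ge_of_dense fun a ha => ?_
  obtain ⟨x, y, hxy, hlt⟩ := exists_decomp_of_interpK_lt ι θ t ha
  refine (interpK_le_of_decomp ι θ t (z := S₁ z) (x := S₀ x) (y := S₁ y)
    (by rw [hxy, map_add, hS])).trans ?_
  simpa using hlt.le

lemma _root_.IsInterpRep.map {z : A₁} {x₁ : ℝ → A₀} {x₂ : ℝ → A₁}
    (h : IsInterpRep ι θ p z x₁ x₂) (S₀ : A₀ ≃ₗᵢ[ℝ] A₀) (S₁ : A₁ ≃ₗᵢ[ℝ] A₁)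
    (hS : ∀ x, ι (S₀ x) = S₁ (ι x)) :
    IsInterpRep ι θ p (S₁ z) (fun t => S₀ (x₁ t)) (fun t => S₁ (x₂ t)) where
  eq_add t := by rw [h.eq_add t, map_add, hS]
  memLp₁ := by
    simp only [← map_smul]
    exact S₀.toContinuousLinearEquiv.toContinuousLinearMap.comp_memLp' h.memLp₁
  memLp₂ := by
    simp only [← map_smul]
    exact S₁.toContinuousLinearEquiv.toContinuousLinearMap.comp_memLp' h.memLp₂

/-- Every representation is carried to one with the same two L_p norms. -/
lemma interpNorm_map_le (S₀ : A₀ ≃ₗᵢ[ℝ] A₀) (S₁ : A₁ ≃ₗᵢ[ℝ] A₁)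
    (hS : ∀ x, ι (S₀ x) = S₁ (ι x)) {z : A₁} (hz : z ∈ interpSet ι θ p) :
    interpNorm ι θ p (S₁ z) ≤ interpNorm ι θ p z := by
  obtain ⟨y₁, y₂, hy⟩ := hz
  rw [interpNorm, interpNorm]
  refine csInf_le_csInf ⟨0, ?_⟩ (by exact ⟨_, y₁, y₂, hy, rfl⟩) ?_
  · rintro _ ⟨x₁, x₂, -, rfl⟩
    positivity
  · rintro _ ⟨x₁, x₂, h, rfl⟩
    refine ⟨_, _, h.map S₀ S₁ hS, ?_⟩
    simp only [← map_smul]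
    rw [eLpNorm_congr_norm_ae (ae_of_all _ fun t => S₀.norm_map _),
      eLpNorm_congr_norm_ae (ae_of_all _ fun t => S₁.norm_map _)]

/-- An isometry of the couple induces an isometry of the interpolation space. -/
lemma exists_isometryEquiv (h : IsInterpolationSpace ι θ p j) (S₀ : A₀ ≃ₗᵢ[ℝ] A₀)
    (S₁ : A₁ ≃ₗᵢ[ℝ] A₁) (hS : ∀ x, ι (S₀ x) = S₁ (ι x)) :
    ∃ T : R ≃ₗᵢ[ℝ] R, ∀ r, j (T r) = S₁ (j r) := by
  have hS' : ∀ x, ι (S₀.symm x) = S₁.symm (ι x) := fun x => by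
    rw [LinearIsometryEquiv.eq_symm_apply, ← hS, S₀.apply_symm_apply]
  have hex : ∀ r, ∃ r', j r' = S₁ (j r) := fun r => by
    obtain ⟨_, _, hr⟩ := h.mem r
    have : S₁ (j r) ∈ interpSet ι θ p := ⟨_, _, hr.map S₀ S₁ hS⟩
    rwa [← h.range_eq] at this
  have hex' : ∀ r, ∃ r', j r' = S₁.symm (j r) := fun r => by
    obtain ⟨_, _, hr⟩ := h.mem r
    have : S₁.symm (j r) ∈ interpSet ι θ p := ⟨_, _, hr.map S₀.symm S₁.symm hS'⟩
    rwa [← h.range_eq] at this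
  choose T hT using hex
  choose T' hT' using hex'
  let L : R ≃ₗ[ℝ] R :=
    { toFun := T
      invFun := T'
      map_add' := fun r s => h.injective (by simp [hT])
      map_smul' := fun c r => h.injective (by simp [hT])
      left_inv := fun r => h.injective (by simp [hT, hT'])
      right_inv := fun r => h.injective (by simp [hT, hT']) }
  refine ⟨⟨L, fun r => ?_⟩, hT⟩
  change ‖T r‖ = ‖r‖
  rw [h.norm_eq, h.norm_eq, hT]
  refine le_antisymm (interpNorm_map_le S₀ S₁ hS (h.mem r)) ?_
  have := interpNorm_map_le (p := p) (θ := θ) (z := S₁ (j r)) S₀.symm S₁.symm hS' (hT r ▸ h.mem _)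
  simpa using this

end IsInterpolationSpace

/-! ### Weak compactness of potentials of separately continuous kernels -/

section WeakConvergence

variable {E : Type*} [NormedAddCommGroup E] [NormedSpace ℝ E]

lemma IsRelWeaklyCompact.mono {K L : Set E} (hL : IsRelWeaklyCompact L) (h : K ⊆ L) :
    IsRelWeaklyCompact K :=
  fun U hU => hL U (mem_of_superset hU h)

lemma IsRelWeaklyCompact.sub {K L : Set E} (hK : IsRelWeaklyCompact K)
    (hL : IsRelWeaklyCompact L) : IsRelWeaklyCompact {x | ∃ y ∈ K, ∃ z ∈ L, x = y - z} := by
  intro U hU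
  have : ∀ x ∈ {x | ∃ y ∈ K, ∃ z ∈ L, x = y - z}, ∃ y ∈ K, ∃ z ∈ L, x = y - z := fun x hx => hx
  choose! y hy z hz hxyz using this
  obtain ⟨a, ha⟩ := hK.exists_tendsto U (w := y) (mem_of_superset hU hy)
  obtain ⟨b, hb⟩ := hL.exists_tendsto U (w := z) (mem_of_superset hU hz)
  refine ⟨a - b, fun φ => ?_⟩
  rw [map_sub]
  refine ((ha φ).sub (hb φ)).congr' (mem_of_superset hU fun x hx => ?_)
  change φ (y x) - φ (z x) = φ x
  rw [← map_sub, ← hxyz x hx]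

end WeakConvergence

section Riesz

variable {S : Type*} [TopologicalSpace S] [CompactSpace S] [T2Space S] [MeasurableSpace S]
  [BorelSpace S]

lemma exists_measure_of_positive (L : C(S, ℝ) →ₗ[ℝ] ℝ) (hL : ∀ g, 0 ≤ g → 0 ≤ L g) :
    ∃ μ : Measure S, IsFiniteMeasure μ ∧ ∀ g : C(S, ℝ), L g = ∫ s, g s ∂μ := by
  let e : CompactlySupportedContinuousMap S ℝ →ₗ[ℝ] C(S, ℝ) :=
    { toFun := fun g => g.toContinuousMap
      map_add' := fun _ _ => rfl
      map_smul' := fun _ _ => rfl }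
  let Λ : CompactlySupportedContinuousMap S ℝ →ₚ[ℝ] ℝ :=
    PositiveLinearMap.mk₀ (L ∘ₗ e) fun g hg => hL _ hg
  refine ⟨RealRMK.rieszMeasure Λ, inferInstance, fun g => ?_⟩
  exact (RealRMK.integral_rieszMeasure Λ
    (CompactlySupportedContinuousMap.continuousMapEquiv g)).symm

/-- Each functional on `C(S)` is a difference of two finite measures. -/
lemma exists_measure_sub_of_dual [Nonempty S] (φ : StrongDual ℝ C(S, ℝ)) :
    ∃ μ ν : Measure S, IsFiniteMeasure μ ∧ IsFiniteMeasure ν ∧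
      ∀ g : C(S, ℝ), φ g = ∫ s, g s ∂μ - ∫ s, g s ∂ν := by
  obtain ⟨s₀⟩ := ‹Nonempty S›
  -- On pairs with constant sum, φ(a - b) + ‖φ‖(a + b) is positive because |a - b| ≤ a + b when a, b
  -- ≥ 0. The Riesz extension to all pairs consists of two positive functionals, and evaluating it
  -- at (g, -g) gives 2φ(g); this accounts for the factors 1/2.
  let cone : PointedCone ℝ (C(S, ℝ) × C(S, ℝ)) :=
    { carrier := {q | 0 ≤ q.1 ∧ 0 ≤ q.2}
      zero_mem' := ⟨le_rfl, le_rfl⟩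
      add_mem' := fun ha hb => ⟨add_nonneg ha.1 hb.1, add_nonneg ha.2 hb.2⟩
      smul_mem' := fun c _ ha => ⟨smul_nonneg c.2 ha.1, smul_nonneg c.2 ha.2⟩ }
  let dom : Submodule ℝ (C(S, ℝ) × C(S, ℝ)) :=
    { carrier := {q | ∀ s, q.1 s + q.2 s = q.1 s₀ + q.2 s₀}
      zero_mem' := fun s => by simp
      add_mem' := fun {a b} ha hb s => by
        have h1 := ha s
        have h2 := hb s
        simp only [Prod.fst_add, Prod.snd_add, ContinuousMap.add_apply]
        linarith
      smul_mem' := fun c a ha s => by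
        simp only [Prod.smul_fst, Prod.smul_snd, ContinuousMap.smul_apply, smul_eq_mul, ← mul_add]
        rw [ha s] }
  let G₀ : C(S, ℝ) × C(S, ℝ) →ₗ[ℝ] ℝ :=
    { toFun := fun q => φ (q.1 - q.2) + ‖φ‖ * (q.1 s₀ + q.2 s₀)
      map_add' := fun a b => by
        simp only [Prod.fst_add, Prod.snd_add, ContinuousMap.add_apply, map_sub, map_add]
        ring
      map_smul' := fun c a => by
        simp only [Prod.smul_fst, Prod.smul_snd, ContinuousMap.smul_apply, smul_eq_mul, map_sub,
          map_smul, RingHom.id_apply]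
        ring }
  obtain ⟨G, hG, hGpos⟩ := riesz_extension cone ⟨dom, G₀.domRestrict dom⟩ (by
    rintro ⟨⟨a, b⟩, hab⟩ ⟨ha, hb⟩
    change 0 ≤ φ (a - b) + ‖φ‖ * (a s₀ + b s₀)
    have hnorm : ‖a - b‖ ≤ a s₀ + b s₀ := by
      have h0 : 0 ≤ a s₀ + b s₀ := add_nonneg (ha s₀) (hb s₀)
      refine (ContinuousMap.norm_le _ h0).2 fun s => ?_
      have h1 : a s + b s = a s₀ + b s₀ := hab s
      have h2 : 0 ≤ a s := ha s
      have h3 : 0 ≤ b s := hb s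
      rw [ContinuousMap.sub_apply, Real.norm_eq_abs, abs_le]
      constructor <;> linarith
    have h1 : |φ (a - b)| ≤ ‖φ‖ * (a s₀ + b s₀) := (φ.le_opNorm _).trans (by gcongr)
    linarith [neg_abs_le (φ (a - b))]) (by
    rintro ⟨a, b⟩
    let c : C(S, ℝ) := ContinuousMap.const S (‖a‖ + ‖b‖)
    refine ⟨⟨(c, c), fun s => rfl⟩, fun s => ?_, fun s => ?_⟩
    · have := neg_abs_le (a s)
      have h1 : |a s| ≤ ‖a‖ := a.norm_coe_le_norm s
      change 0 ≤ (‖a‖ + ‖b‖) + a s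
      linarith [norm_nonneg b]
    · have := neg_abs_le (b s)
      have h1 : |b s| ≤ ‖b‖ := b.norm_coe_le_norm s
      change 0 ≤ (‖a‖ + ‖b‖) + b s
      linarith [norm_nonneg a])
  obtain ⟨μ, hμ, hμG⟩ := exists_measure_of_positive (G ∘ₗ LinearMap.inl ℝ _ _)
    fun g hg => hGpos _ ⟨hg, le_rfl⟩
  obtain ⟨ν, hν, hνG⟩ := exists_measure_of_positive (G ∘ₗ LinearMap.inr ℝ _ _)
    fun g hg => hGpos _ ⟨le_rfl, hg⟩
  have hG' : ∀ f : C(S, ℝ), G (f, -f) = 2 * φ f := fun f => by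
    have := hG ⟨(f, -f), fun s => by simp⟩
    rw [this]
    change φ (f - -f) + ‖φ‖ * (f s₀ + -f s₀) = _
    rw [sub_neg_eq_add, map_add]
    ring
  refine ⟨(1 / 2 : NNReal) • μ, (1 / 2 : NNReal) • ν, inferInstance, inferInstance, fun g => ?_⟩
  have h1 : G (g, -g) = G (g, 0) - G (0, g) := by
    rw [← map_sub]
    simp
  have h2 := hμG g
  have h3 := hνG g
  simp only [LinearMap.comp_apply, LinearMap.inl_apply, LinearMap.inr_apply] at h2 h3
  rw [hG', h2, h3] at h1
  rw [integral_smul_nnreal_measure, integral_smul_nnreal_measure]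
  simp only [NNReal.smul_def, smul_eq_mul]
  push_cast
  linarith

end Riesz

section Kernel

variable {S : Type*} [TopologicalSpace S] [CompactSpace S] [TopologicalSpace.MetrizableSpace S]
  [MeasurableSpace S] [BorelSpace S]

/-- A symmetric separately continuous kernel on `S` with values in `[-1, 1]`. -/
structure IsSepContKernel (F : S → S → ℝ) : Prop where
  symm : ∀ σ τ, F σ τ = F τ σ
  continuous : ∀ σ, Continuous (F σ)
  abs_le : ∀ σ τ, |F σ τ| ≤ 1

namespace IsSepContKernel

variable {F : S → S → ℝ} (hF : IsSepContKernel F)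

/-- The potential of a finite measure with respect to a separately continuous kernel. -/
noncomputable def potential (μ : Measure S) [IsFiniteMeasure μ] : C(S, ℝ) where
  toFun σ := ∫ τ, F σ τ ∂μ
  continuous_toFun := by
    refine continuous_of_dominated (bound := fun _ => 1)
      (fun σ => (hF.continuous σ).aestronglyMeasurable)
      (fun σ => ae_of_all _ fun τ => hF.abs_le σ τ) (integrable_const 1)
      (ae_of_all _ fun τ => ?_)
    simp only [fun σ => hF.symm σ τ]
    exact hF.continuous τ

/-- Fubini applies since a separately continuous kernel on a compact metrizable space is jointly
measurable. The identity moves a test measure onto the kernel, leaving a continuous integrand. -/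
lemma integral_potential (μ ν : Measure S) [IsFiniteMeasure μ] [IsFiniteMeasure ν] :
    ∫ σ, hF.potential μ σ ∂ν = ∫ σ, hF.potential ν σ ∂μ := by
  have hmeas : Measurable (Function.uncurry F) := by
    refine measurable_uncurry_of_continuous_of_measurable (fun τ => ?_)
      fun σ => (hF.continuous σ).measurable
    simp only [fun σ => hF.symm σ τ]
    exact hF.continuous τ
  have hint : Integrable (Function.uncurry F) (ν.prod μ) :=
    Integrable.of_bound hmeas.aestronglyMeasurable 1 (ae_of_all _ fun q => hF.abs_le q.1 q.2)
  change ∫ σ, ∫ τ, F σ τ ∂μ ∂ν = ∫ σ, ∫ τ, F σ τ ∂ν ∂μ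
  rw [integral_integral_swap hint]
  simp only [fun σ τ => hF.symm σ τ]

end IsSepContKernel

end Kernel

section Potentials

variable {X S : Type*} [TopologicalSpace X] [MeasurableSpace X] [BorelSpace X]
  [TopologicalSpace S] [CompactSpace S] [TopologicalSpace.MetrizableSpace S]
  [MeasurableSpace S] [BorelSpace S]

/-- The potentials on `X` of positive measures of mass at most one, with respect to a kernel that
extends to a separately continuous kernel on a metrizable compactification, form a relatively
weakly compact subset of `C_b(X)`. -/
lemma isRelWeaklyCompact_potentials [Nonempty S] {F : S → S → ℝ} (hF : IsSepContKernel F)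
    {h : X → S} (hh : Continuous h) :
    IsRelWeaklyCompact {f : X →ᵇ ℝ | ∃ P : Measure X, P univ ≤ 1 ∧
      ∀ y, f y = ∫ x, F (h x) (h y) ∂P} := by
  intro U hU
  have hex : ∀ f ∈ {f : X →ᵇ ℝ | ∃ P : Measure X, P univ ≤ 1 ∧
      ∀ y, f y = ∫ x, F (h x) (h y) ∂P}, ∃ P : Measure X, P univ ≤ 1 ∧
      ∀ y, f y = ∫ x, F (h x) (h y) ∂P := fun f hf => hf
  choose! P hP1 hPf using hex
  let κ : (X →ᵇ ℝ) → Measure S := fun f => (P f).map h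
  have hκ1 : ∀ᶠ f in (U : Filter (X →ᵇ ℝ)), κ f univ ≤ 1 := by
    filter_upwards [hU] with f hf
    change (P f).map h univ ≤ 1
    rw [Measure.map_apply hh.measurable MeasurableSet.univ, preimage_univ]
    exact hP1 f hf
  have hfin : ∀ {μ : Measure S}, μ univ ≤ 1 → IsFiniteMeasure μ :=
    fun hμ => ⟨hμ.trans_lt ENNReal.one_lt_top⟩
  -- Weak-star compactness: bounded integrals converge along the ultrafilter, and the limit
  -- functional is positive, hence a measure `lam`.
  have hlim : ∀ g : C(S, ℝ), ∃ a, Tendsto (fun f => ∫ s, g s ∂(κ f)) U (𝓝 a) := by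
    intro g
    have hmem : ∀ᶠ f in (U : Filter (X →ᵇ ℝ)), ∫ s, g s ∂(κ f) ∈ Metric.closedBall 0 ‖g‖ := by
      filter_upwards [hκ1] with f hf
      have := hfin hf
      rw [mem_closedBall_zero_iff]
      refine (norm_integral_le_of_norm_le_const
        (ae_of_all _ fun s => g.norm_coe_le_norm s)).trans ?_
      refine mul_le_of_le_one_right (norm_nonneg g) ?_
      exact ENNReal.toReal_le_of_le_ofReal zero_le_one (by simpa using hf)
    obtain ⟨a, -, ha⟩ := (isCompact_closedBall (0 : ℝ) ‖g‖).ultrafilter_le_nhds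
      (U.map fun f => ∫ s, g s ∂(κ f)) (le_principal_iff.2 hmem)
    exact ⟨a, ha⟩
  choose L hL using hlim
  let Llin : C(S, ℝ) →ₗ[ℝ] ℝ :=
    { toFun := L
      map_add' := fun g g' => by
        refine tendsto_nhds_unique (hL (g + g')) (((hL g).add (hL g')).congr' ?_)
        filter_upwards [hκ1] with f hf
        have := hfin hf
        rw [← integral_add (g.continuous.integrable_of_hasCompactSupport
          (HasCompactSupport.of_compactSpace _)) (g'.continuous.integrable_of_hasCompactSupport
          (HasCompactSupport.of_compactSpace _))]
        rfl
      map_smul' := fun c g => by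
        refine tendsto_nhds_unique (hL (c • g)) (((hL g).const_smul c).congr fun f => ?_)
        rw [← integral_smul]
        rfl }
  obtain ⟨lam, hlam, hlamL⟩ := exists_measure_of_positive Llin fun g hg =>
    ge_of_tendsto (hL g) (Eventually.of_forall fun f => integral_nonneg fun s => hg s)
  let pull : C(S, ℝ) →L[ℝ] (X →ᵇ ℝ) :=
    LinearMap.mkContinuous
      { toFun := fun g => (BoundedContinuousFunction.mkOfCompact g).compContinuous ⟨h, hh⟩
        map_add' := fun _ _ => rfl
        map_smul' := fun _ _ => rfl } 1 fun g => by
      rw [one_mul]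
      exact (BoundedContinuousFunction.norm_le (norm_nonneg g)).2 fun x => g.norm_coe_le_norm (h x)
  refine ⟨pull (hF.potential lam), fun φ => ?_⟩
  obtain ⟨μ, ν, hμ, hν, hφ⟩ := exists_measure_sub_of_dual (φ.comp pull)
  -- A functional of a potential is the integral of fixed continuous functions against `κ'`, so it
  -- passes to the limit by the construction of `lam`.
  have hφ' : ∀ κ' : Measure S, ∀ _ : IsFiniteMeasure κ', φ (pull (hF.potential κ')) =
      ∫ s, hF.potential μ s ∂κ' - ∫ s, hF.potential ν s ∂κ' := fun κ' _ => by
    have := hφ (hF.potential κ')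
    rw [ContinuousLinearMap.comp_apply] at this
    rw [this, hF.integral_potential κ' μ, hF.integral_potential κ' ν]
  rw [hφ' lam hlam, ← hlamL, ← hlamL]
  refine ((hL _).sub (hL _)).congr' ?_
  filter_upwards [hU, hκ1] with f hf hf1
  have := hfin hf1
  rw [← hφ' (κ f) this]
  congr 1
  ext y
  rw [hPf f hf y]
  change ∫ s, F (h y) s ∂((P f).map h) = _
  rw [integral_map hh.measurable.aemeasurable (hF.continuous _).aestronglyMeasurable]
  exact integral_congr_ae (ae_of_all _ fun x => hF.symm _ _)

end Potentials

/-! ### The compactification of a stable space -/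

section TypeSpace

lemma abs_exp_neg_sub_exp_neg_le {a b : ℝ} (ha : 0 ≤ a) (hb : 0 ≤ b) :
    |Real.exp (-a) - Real.exp (-b)| ≤ |a - b| := by
  wlog hab : a ≤ b generalizing a b
  · rw [abs_sub_comm, abs_sub_comm a]
    exact this hb ha (le_of_not_ge hab)
  have h1 : Real.exp (-b) ≤ Real.exp (-a) := Real.exp_le_exp.2 (by linarith)
  rw [abs_of_nonneg (by linarith), abs_of_nonpos (by linarith)]
  have h2 : Real.exp (-b) = Real.exp (-a) * Real.exp (a - b) := by
    rw [← Real.exp_add]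
    ring_nf
  have h3 := Real.add_one_le_exp (a - b)
  have h4 : Real.exp (-a) ≤ 1 := Real.exp_le_one_iff.2 (by linarith)
  have h5 := Real.exp_pos (-a)
  rw [h2]
  nlinarith

lemma abs_exp_neg_norm_sub_le {X : Type*} [NormedAddCommGroup X] (u v : X) :
    |Real.exp (-‖u‖) - Real.exp (-‖v‖)| ≤ ‖u - v‖ :=
  (abs_exp_neg_sub_exp_neg_le (norm_nonneg u) (norm_nonneg v)).trans (abs_norm_sub_norm_le u v)

variable {X S : Type*} [NormedAddCommGroup X] [TopologicalSpace S]

/-- `E y` is the continuous extension to `S` of the function `x ↦ exp (-‖x - y‖)`, where `h : X → S`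
is dense. -/
structure IsExpExtension (h : X → S) (E : X → S → ℝ) : Prop where
  dense : IsDenseInducing h
  continuous : ∀ y, Continuous (E y)
  apply_eq : ∀ x y, E y (h x) = Real.exp (-‖x - y‖)

namespace IsExpExtension

variable {h : X → S} {E : X → S → ℝ}

lemma nonneg (hE : IsExpExtension h E) (z : X) (σ : S) : 0 ≤ E z σ := by
  induction σ using hE.dense.dense.induction_on with
  | hp => exact isClosed_le continuous_const (hE.continuous z)
  | ih x => rw [hE.apply_eq]; positivity

lemma le_one (hE : IsExpExtension h E) (z : X) (σ : S) : E z σ ≤ 1 := by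
  induction σ using hE.dense.dense.induction_on with
  | hp => exact isClosed_le (hE.continuous z) continuous_const
  | ih x => rw [hE.apply_eq]; exact Real.exp_le_one_iff.2 (by simp)

/-- The triangle inequality, extended from X by density. With `exp_neg_mul_le` it shows that at a
point σ the values `E z σ` vanish for all `z` or for none; `E 0 σ = 0` marks the points at infinity.
-/
lemma le_exp_mul (hE : IsExpExtension h E) (z : X) (σ : S) : E z σ ≤ Real.exp ‖z‖ * E 0 σ := by
  induction σ using hE.dense.dense.induction_on with
  | hp => exact isClosed_le (hE.continuous z) (continuous_const.mul (hE.continuous 0))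
  | ih x =>
    rw [hE.apply_eq, hE.apply_eq, ← Real.exp_add, Real.exp_le_exp, sub_zero]
    linarith [norm_le_norm_sub_add x z]

lemma exp_neg_mul_le (hE : IsExpExtension h E) (z : X) (σ : S) :
    Real.exp (-‖z‖) * E 0 σ ≤ E z σ := by
  induction σ using hE.dense.dense.induction_on with
  | hp => exact isClosed_le (continuous_const.mul (hE.continuous 0)) (hE.continuous z)
  | ih x =>
    rw [hE.apply_eq, hE.apply_eq, ← Real.exp_add, Real.exp_le_exp, sub_zero]
    linarith [norm_sub_le x z]

lemma mul_le_exp_neg (hE : IsExpExtension h E) (z : X) (σ : S) :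
    E z σ * E 0 σ ≤ Real.exp (-‖z‖) := by
  induction σ using hE.dense.dense.induction_on with
  | hp => exact isClosed_le ((hE.continuous z).mul (hE.continuous 0)) continuous_const
  | ih x =>
    rw [hE.apply_eq, hE.apply_eq, ← Real.exp_add, Real.exp_le_exp, sub_zero]
    have := norm_le_norm_sub_add z x
    rw [norm_sub_rev] at this
    linarith

lemma tendsto (hE : IsExpExtension h E) {x : ℕ → X} {σ : S}
    (hx : Tendsto (fun n => h (x n)) atTop (𝓝 σ)) (z : X) :
    Tendsto (fun n => Real.exp (-‖x n - z‖)) atTop (𝓝 (E z σ)) := by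
  have := ((hE.continuous z).tendsto σ).comp hx
  simpa only [Function.comp_def, hE.apply_eq] using this

/-- Sequences converging to a finite point of `S` have convergent distances to every `z`, hence are
type determining up to sign. -/
lemma tendsto_norm_sub (hE : IsExpExtension h E) {x : ℕ → X} {σ : S}
    (hx : Tendsto (fun n => h (x n)) atTop (𝓝 σ)) (hσ : 0 < E 0 σ) (z : X) :
    Tendsto (fun n => ‖x n - z‖) atTop (𝓝 (-Real.log (E z σ))) := by
  have hpos : 0 < E z σ :=
    (mul_pos (Real.exp_pos _) hσ).trans_le (hE.exp_neg_mul_le z σ)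
  simpa using ((hE.tendsto hx z).log hpos.ne').neg

/-- The case at infinity, where stability does not apply. Here ‖x n‖ → ∞, and when `τ` is finite
`mul_le_exp_neg` forces the values `E (x n) τ` to zero. -/
lemma limits_eq_zero (hE : IsExpExtension h E) {x y : ℕ → X} {σ τ : S}
    (hx : Tendsto (fun n => h (x n)) atTop (𝓝 σ)) {l l' : ℝ}
    (hl : Tendsto (fun m => E (y m) σ) atTop (𝓝 l))
    (hl' : Tendsto (fun n => E (x n) τ) atTop (𝓝 l')) (hσ : E 0 σ = 0) : l = 0 ∧ l' = 0 := by
  have hzero : ∀ {σ : S}, E 0 σ = 0 → ∀ z, E z σ = 0 := fun {σ} hσ z =>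
    le_antisymm (by simpa [hσ] using hE.le_exp_mul z σ) (hE.nonneg z σ)
  refine ⟨tendsto_nhds_unique hl (by simp [hzero hσ]), ?_⟩
  rcases eq_or_ne (E 0 τ) 0 with hτ | hτ
  · exact tendsto_nhds_unique hl' (by simp [hzero hτ])
  · have h1 : Tendsto (fun n => Real.exp (-‖x n‖)) atTop (𝓝 0) := by
      simpa [hσ] using hE.tendsto hx 0
    have h2 : Tendsto (fun n => E (x n) τ * E 0 τ) atTop (𝓝 0) :=
      squeeze_zero (fun n => mul_nonneg (hE.nonneg _ _) (hE.nonneg _ _))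
        (fun n => hE.mul_le_exp_neg (x n) τ) h1
    exact (mul_eq_zero.1 (tendsto_nhds_unique (hl'.mul_const _) h2)).resolve_right hτ

lemma limit_pos (hE : IsExpExtension h E) {x : ℕ → X} {σ τ : S}
    (hx : Tendsto (fun n => h (x n)) atTop (𝓝 σ)) {l' : ℝ}
    (hl' : Tendsto (fun n => E (x n) τ) atTop (𝓝 l')) (hσ : 0 < E 0 σ) (hτ : 0 < E 0 τ) :
    0 < l' := by
  have h1 : Tendsto (fun n => Real.exp (-‖x n‖) * E 0 τ) atTop (𝓝 (E 0 σ * E 0 τ)) := by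
    simpa using (hE.tendsto hx 0).mul_const (E 0 τ)
  exact (mul_pos hσ hτ).trans_le (le_of_tendsto_of_tendsto' h1 hl' fun n =>
    hE.exp_neg_mul_le (x n) τ)

/-- The one place where stability enters. At finite points both limits are positive, so logarithms
turn them into iterated limits of norms. -/
lemma limits_eq (hE : IsExpExtension h E) (hX : IsStable X) {x y : ℕ → X} {σ τ : S}
    (hx : Tendsto (fun n => h (x n)) atTop (𝓝 σ)) (hy : Tendsto (fun n => h (y n)) atTop (𝓝 τ))
    {l l' : ℝ} (hl : Tendsto (fun m => E (y m) σ) atTop (𝓝 l))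
    (hl' : Tendsto (fun n => E (x n) τ) atTop (𝓝 l')) : l = l' := by
  rcases (hE.nonneg 0 σ).eq_or_lt' with hσ | hσ
  · obtain ⟨h1, h2⟩ := hE.limits_eq_zero hx hl hl' hσ
    rw [h1, h2]
  rcases (hE.nonneg 0 τ).eq_or_lt' with hτ | hτ
  · obtain ⟨h1, h2⟩ := hE.limits_eq_zero hy hl' hl hτ
    rw [h1, h2]
  have hlpos := hE.limit_pos hy hl hτ hσ
  have hlpos' := hE.limit_pos hx hl' hσ hτ
  -- Stability concerns sums and the kernel differences, hence the sign.
  have key := hX x (fun m => -y m) ⟨fun z => -Real.log (E (-z) σ), fun z => by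
      simpa [sub_neg_eq_add, add_comm] using hE.tendsto_norm_sub hx hσ (-z)⟩
    ⟨fun z => -Real.log (E z τ), fun z => by
      have := hE.tendsto_norm_sub hy hτ z
      simpa [norm_sub_rev _ z, ← sub_eq_add_neg] using this⟩ (-Real.log l') (-Real.log l)
    ⟨fun n => -Real.log (E (x n) τ), fun n => by
      have := hE.tendsto_norm_sub hy hτ (x n)
      simpa [norm_sub_rev _ (x n), ← sub_eq_add_neg] using this, (hl'.log hlpos'.ne').neg⟩
    ⟨fun m => -Real.log (E (y m) σ), fun m => by
      simpa [← sub_eq_add_neg] using hE.tendsto_norm_sub hx hσ (y m), (hl.log hlpos.ne').neg⟩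
  exact Real.log_injOn_pos hlpos hlpos' (neg_injective key).symm

lemma exists_seq_tendsto [FirstCountableTopology S] (hE : IsExpExtension h E) (σ : S) :
    ∃ x : ℕ → X, Tendsto (fun n => h (x n)) atTop (𝓝 σ) := by
  obtain ⟨s, hs, hlim⟩ := mem_closure_iff_seq_limit.1 (hE.dense.dense σ)
  choose x hx using hs
  exact ⟨x, by simpa only [hx] using hlim⟩

/-- Fix `x` tending to `σ` with `E (x n) τ` convergent to `c`. By `limits_eq` every sequence tending
to `τ` has a subsequence along which the values tend to this same `c`. -/
lemma exists_tendsto_comap [FirstCountableTopology S] (hE : IsExpExtension h E) (hX : IsStable X)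
    (σ τ : S) : ∃ c, Tendsto (fun y => E y σ) (comap h (𝓝 τ)) (𝓝 c) := by
  obtain ⟨x, hx⟩ := hE.exists_seq_tendsto σ
  have hI : ∀ z σ, E z σ ∈ Icc (0 : ℝ) 1 := fun z σ => ⟨hE.nonneg z σ, hE.le_one z σ⟩
  obtain ⟨c, -, φ, hφ, hc⟩ := isCompact_Icc.tendsto_subseq fun n => hI (x n) τ
  refine ⟨c, tendsto_of_subseq_tendsto fun y hy => ?_⟩
  obtain ⟨c', -, ψ, hψ, hc'⟩ := isCompact_Icc.tendsto_subseq fun n => hI (y n) σ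
  refine ⟨ψ, ?_⟩
  have : c' = c := hE.limits_eq hX (hx.comp hφ.tendsto_atTop)
    ((tendsto_comap_iff.1 hy).comp hψ.tendsto_atTop) hc' hc
  rw [← this]
  exact hc'

/-- `F σ τ` is the limit of `E y σ` as `y` tends to `τ`. Symmetry is the interchange of limits, and
gives continuity in the other variable. -/
lemma exists_isSepContKernel [FirstCountableTopology S] (hE : IsExpExtension h E)
    (hX : IsStable X) : ∃ F : S → S → ℝ, IsSepContKernel F ∧
      ∀ x y, F (h x) (h y) = Real.exp (-‖x - y‖) := by
  let F : S → S → ℝ := fun σ => hE.dense.extend fun y => E y σ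
  have hlim : ∀ σ τ, Tendsto (fun y => E y σ) (comap h (𝓝 τ)) (𝓝 (F σ τ)) := fun σ τ => by
    obtain ⟨c, hc⟩ := hE.exists_tendsto_comap hX σ τ
    have : F σ τ = c := hE.dense.extend_eq_of_tendsto hc
    rwa [this]
  refine ⟨F, ⟨fun σ τ => ?_, fun σ => hE.dense.continuous_extend (hE.exists_tendsto_comap hX σ),
    fun σ τ => ?_⟩, fun x y => ?_⟩
  · obtain ⟨x, hx⟩ := hE.exists_seq_tendsto σ
    obtain ⟨y, hy⟩ := hE.exists_seq_tendsto τ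
    exact hE.limits_eq hX hx hy ((hlim σ τ).comp (tendsto_comap_iff.2 hy))
      ((hlim τ σ).comp (tendsto_comap_iff.2 hx))
  · have := hE.dense.comap_nhds_neBot τ
    have h0 : 0 ≤ F σ τ := ge_of_tendsto (hlim σ τ) (Eventually.of_forall fun y => hE.nonneg y σ)
    rw [abs_of_nonneg h0]
    exact le_of_tendsto (hlim σ τ) (Eventually.of_forall fun y => hE.le_one y σ)
  · exact (hE.dense.extend_eq' (hE.exists_tendsto_comap hX (h x)) y).trans (hE.apply_eq x y)

end IsExpExtension

/-- `S` is the closure of the image of X in the cube [0,1]^ℕ under the functions e^{-‖x-d_n‖}. The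
function for a general `y` extends because it is uniformly close to a coordinate. -/
lemma exists_isExpExtension [TopologicalSpace.SeparableSpace X] :
    ∃ (S : Set (ℕ → ℝ)) (h : X → S) (E : X → S → ℝ), IsCompact S ∧ IsExpExtension h E := by
  let d := TopologicalSpace.denseSeq X
  have hd : DenseRange d := TopologicalSpace.denseRange_denseSeq X
  let h₀ : X → ℕ → ℝ := fun x n => Real.exp (-‖x - d n‖)
  have hcont : Continuous h₀ := continuous_pi fun n => by fun_prop
  have hcomp : IsCompact (closure (range h₀)) := by
    refine (isCompact_univ_pi fun _ : ℕ => isCompact_Icc (a := (0 : ℝ)) (b := 1)).of_isClosed_subset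
      isClosed_closure (closure_minimal ?_ (isClosed_set_pi fun _ _ => isClosed_Icc))
    rintro _ ⟨x, rfl⟩ n -
    exact ⟨(Real.exp_pos _).le, Real.exp_le_one_iff.2 (by simp)⟩
  let h : X → closure (range h₀) := fun x => ⟨h₀ x, subset_closure (mem_range_self x)⟩
  have hdense : IsDenseInducing h := by
    refine IsDenseInducing.mk' h (hcont.subtype_mk _) (fun σ => ?_) fun a s hs => ?_
    · have : DenseRange h := by
        rw [DenseRange, Subtype.dense_iff]
        intro σ hσ
        rwa [← range_comp]
      exact this σ
    · obtain ⟨ε, hε, hs⟩ := Metric.mem_nhds_iff.1 hs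
      obtain ⟨_, hn, n, rfl⟩ := Metric.dense_iff.1 hd a (ε / 2) (half_pos hε)
      rw [Metric.mem_ball, dist_comm, dist_eq_norm] at hn
      -- A large n-th coordinate means closeness to `d n`, hence to `a`.
      refine ⟨{σ | Real.exp (-(ε / 2)) < σ.1 n}, ?_, fun b hb => hs ?_⟩
      · refine (isOpen_lt continuous_const
          ((continuous_apply n).comp continuous_subtype_val)).mem_nhds ?_
        exact Real.exp_lt_exp.2 (by linarith)
      · have hb' : ‖b - d n‖ < ε / 2 := by
          have := Real.exp_lt_exp.1 hb
          linarith
        rw [Metric.mem_ball, dist_eq_norm]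
        have := norm_sub_le (b - d n) (a - d n)
        rw [sub_sub_sub_cancel_right] at this
        linarith
  have hlim : ∀ y, ∀ σ, ∃ c, Tendsto (fun x => Real.exp (-‖x - y‖)) (comap h (𝓝 σ)) (𝓝 c) := by
    intro y σ
    have := hdense.comap_nhds_neBot σ
    refine cauchy_map_iff_exists_tendsto.1 ?_
    refine Metric.cauchy_iff.2 ⟨inferInstance, fun ε hε => ?_⟩
    obtain ⟨_, hn, n, rfl⟩ := Metric.dense_iff.1 hd y (ε / 4) (by positivity)
    rw [Metric.mem_ball, dist_eq_norm] at hn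
    have hσ : Tendsto (fun x => h₀ x n) (comap h (𝓝 σ)) (𝓝 (σ.1 n)) :=
      (((continuous_apply n).comp continuous_subtype_val).tendsto σ).comp tendsto_comap
    have hclose := Metric.tendsto_nhds.1 hσ (ε / 4) (by positivity)
    have hdist : ∀ x, |Real.exp (-‖x - y‖) - h₀ x n| < ε / 4 := fun x => by
      refine (abs_exp_neg_norm_sub_le _ _).trans_lt ?_
      rwa [sub_sub_sub_cancel_left]
    refine ⟨_, image_mem_map hclose, ?_⟩
    rintro _ ⟨x, hx, rfl⟩ _ ⟨x', hx', rfl⟩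
    simp only [mem_ofPred_eq, Real.dist_eq] at hx hx' ⊢
    have h1 := abs_lt.1 (hdist x)
    have h2 := abs_lt.1 (hdist x')
    have h3 := abs_lt.1 hx
    have h4 := abs_lt.1 hx'
    rw [abs_lt]
    constructor <;> linarith [h1.1, h1.2, h2.1, h2.2, h3.1, h3.2, h4.1, h4.2]
  exact ⟨_, h, fun y => hdense.extend fun x => Real.exp (-‖x - y‖), hcomp, hdense,
    fun y => hdense.continuous_extend (hlim y), fun x y => hdense.extend_eq' (hlim y) x⟩

/-- The potentials `y ↦ ∫ exp (-‖x - y‖) P(dx)` of positive measures of mass at most one on a stable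
space form a relatively weakly compact set. -/
lemma IsStable.isRelWeaklyCompact_potentials [MeasurableSpace X] [BorelSpace X]
    [TopologicalSpace.SeparableSpace X] (hX : IsStable X) :
    IsRelWeaklyCompact {f : X →ᵇ ℝ | ∃ P : Measure X, P univ ≤ 1 ∧
      ∀ y, f y = ∫ x, Real.exp (-‖x - y‖) ∂P} := by
  obtain ⟨S, h, E, hS, hE⟩ := exists_isExpExtension (X := X)
  have : CompactSpace S := isCompact_iff_compactSpace.1 hS
  obtain ⟨F, hF, hFe⟩ := hE.exists_isSepContKernel hX
  have : Nonempty S := ⟨h 0⟩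
  have := _root_.isRelWeaklyCompact_potentials hF hE.dense.continuous
  simpa only [hFe] using this

end TypeSpace

/-! ### Translations of C_b(X) and of Φ(M(X)) -/

/-- Translation as an isometry of `C_b(X)`. -/
noncomputable def translateBCF {X : Type*} [NormedAddCommGroup X] (z : X) :
    (X →ᵇ ℝ) ≃ₗᵢ[ℝ] (X →ᵇ ℝ) where
  toFun f := f.compContinuous ⟨fun x => x - z, by fun_prop⟩
  invFun f := f.compContinuous ⟨fun x => x + z, by fun_prop⟩
  map_add' _ _ := rfl
  map_smul' _ _ := rfl
  left_inv f := by ext x; simp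
  right_inv f := by ext x; simp
  norm_map' f := by
    refine le_antisymm ?_ ?_
    · exact (BoundedContinuousFunction.norm_le (norm_nonneg f)).2 fun x => f.norm_coe_le_norm _
    · refine (BoundedContinuousFunction.norm_le (norm_nonneg _)).2 fun x => ?_
      have h := (f.compContinuous ⟨fun x => x - z, by fun_prop⟩).norm_coe_le_norm (x + z)
      rw [BoundedContinuousFunction.compContinuous_apply, ContinuousMap.coe_mk,
        add_sub_cancel_right] at h
      exact h

lemma translateBCF_apply {X : Type*} [NormedAddCommGroup X] (z : X) (f : X →ᵇ ℝ) (x : X) :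
    translateBCF z f x = f (x - z) := rfl

section Phi

variable {X : Type u} [NormedAddCommGroup X] [MeasurableSpace X] [BorelSpace X]

lemma integral_toSignedMeasure_real {Y : Type*} [MeasurableSpace Y] (f : Y → ℝ) (P : Measure Y)
    [IsFiniteMeasure P] :
    ∫ᵛ x, f x ∂•P.toSignedMeasure = ∫ x, f x ∂P := by
  rw [← VectorMeasure.integral_toSignedMeasure]
  congr 1
  ext
  simp

lemma integrable_exp_neg_norm_sub (P : Measure X) [IsFiniteMeasure P] (y : X) :
    Integrable (fun x => Real.exp (-‖x - y‖)) P :=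
  Integrable.of_bound (continuous_exp_neg_norm y).aestronglyMeasurable 1
    (ae_of_all _ fun x => norm_exp_neg_norm_le (x - y))

lemma Phi_toSignedMeasure_apply (P : Measure X) [IsFiniteMeasure P] (y : X) :
    Phi X P.toSignedMeasure y = ∫ x, Real.exp (-‖x - y‖) ∂P := by
  rw [Phi_apply, integral_toSignedMeasure_real]

lemma eq_posPart_sub_negPart {Y : Type*} [MeasurableSpace Y] (μ : SignedMeasure Y) :
    μ = μ.toJordanDecomposition.posPart.toSignedMeasure -
      μ.toJordanDecomposition.negPart.toSignedMeasure :=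
  μ.toSignedMeasure_toJordanDecomposition.symm

lemma posPart_univ_le {Y : Type*} [MeasurableSpace Y] {μ : SignedMeasure Y}
    (h : measureNorm μ ≤ 1) :
    μ.toJordanDecomposition.posPart univ ≤ 1 ∧ μ.toJordanDecomposition.negPart univ ≤ 1 := by
  have h1 : μ.totalVariation univ ≤ 1 := by
    rw [← ENNReal.ofReal_toReal (measure_ne_top μ.totalVariation univ)]
    exact ENNReal.ofReal_le_one.2 h
  rw [SignedMeasure.totalVariation, Measure.add_apply] at h1
  exact ⟨le_self_add.trans h1, le_add_self.trans h1⟩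

lemma exists_eq_smul_of_gauge_lt {f : PhiRange X} {b : ℝ} (hf : ‖f‖ < b) :
    ∃ c, 0 < c ∧ c < b ∧ ∃ μ : SignedMeasure X, measureNorm μ ≤ 1 ∧
      PhiRange.incl X f = c • Phi X μ := by
  obtain ⟨c, hc, hcb, g, ⟨μ, hμ, h⟩, rfl⟩ := exists_lt_of_gauge_lt absorbent_PhiBall hf
  refine ⟨c, hc, hcb, μ, hμ, ?_⟩
  rw [h]
  rfl

lemma Phi_mem_potentials_sub {μ : SignedMeasure X} (hμ : measureNorm μ ≤ 1) :
    Phi X μ ∈ {f : X →ᵇ ℝ | ∃ g ∈ {f : X →ᵇ ℝ | ∃ P : Measure X, P univ ≤ 1 ∧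
      ∀ y, f y = ∫ x, Real.exp (-‖x - y‖) ∂P}, ∃ g' ∈ {f : X →ᵇ ℝ | ∃ P : Measure X, P univ ≤ 1 ∧
      ∀ y, f y = ∫ x, Real.exp (-‖x - y‖) ∂P}, f = g - g'} := by
  obtain ⟨h1, h2⟩ := posPart_univ_le hμ
  refine ⟨Phi X μ.toJordanDecomposition.posPart.toSignedMeasure,
    ⟨_, h1, Phi_toSignedMeasure_apply _⟩, Phi X μ.toJordanDecomposition.negPart.toSignedMeasure,
    ⟨_, h2, Phi_toSignedMeasure_apply _⟩, ?_⟩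
  rw [← map_sub, ← eq_posPart_sub_negPart]

/-- The inclusion of `A₀` in `C_b(X)` is weakly compact if `X` is stable. -/
lemma isRelWeaklyCompact_incl [TopologicalSpace.SeparableSpace X] (hX : IsStable X) :
    IsRelWeaklyCompact (PhiRange.incl X '' Metric.closedBall 0 1) := by
  have hK := hX.isRelWeaklyCompact_potentials
  refine ((hK.sub hK).smul 2).mono ?_
  rintro _ ⟨f, hf, rfl⟩
  -- The gauge need not be attained, so the closed unit ball is placed inside twice the image of the
  -- unit ball.
  obtain ⟨c, hc, hc2, μ, hμ, hfμ⟩ := exists_eq_smul_of_gauge_lt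
    (show ‖f‖ < 2 by linarith [mem_closedBall_zero_iff.1 hf])
  refine ⟨Phi X ((c / 2) • μ), Phi_mem_potentials_sub ?_, ?_⟩
  · rw [measureNorm_smul, abs_of_pos (by positivity)]
    exact mul_le_one₀ (by linarith) ENNReal.toReal_nonneg hμ
  · rw [hfμ, map_smul, smul_smul]
    congr 1
    ring

lemma measureNorm_map_le {Y : Type*} [MeasurableSpace Y] (μ : SignedMeasure Y)
    {φ : Y → Y} (hφ : Measurable φ) :
    measureNorm (μ.map φ) ≤ measureNorm μ := by
  rw [measureNorm_eq, measureNorm_eq]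
  refine ENNReal.toReal_mono (measure_ne_top _ _) ((VectorMeasure.variation_map_le univ).trans ?_)
  rw [Measure.map_apply hφ MeasurableSet.univ, preimage_univ]

/-- The kernel depends only on x - y, so pushing a measure forward by a translation translates its
potential. -/
lemma Phi_map_add (μ : SignedMeasure X) (z : X) :
    Phi X (μ.map fun x => x + z) = translateBCF z (Phi X μ) := by
  ext y
  have hm : Measurable fun x : X => x + z := (continuous_add_const z).measurable
  rw [translateBCF_apply, Phi_apply, Phi_apply, VectorMeasure.integral_map hm
    (continuous_exp_neg_norm y).aestronglyMeasurable]
  · simp only [add_sub_right_comm, sub_sub_eq_add_sub]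
  · refine Integrable.of_bound (((continuous_exp_neg_norm y).comp
      (continuous_add_const z)).aestronglyMeasurable) 1 (ae_of_all _ fun x => ?_)
    exact norm_exp_neg_norm_le (x + z - y)

lemma translateBCF_mem_range (z : X) (f : PhiRange X) :
    translateBCF z (PhiRange.toBCF X f) ∈ LinearMap.range (Phi X) := by
  obtain ⟨μ, hμ⟩ : ∃ μ, Phi X μ = PhiRange.toBCF X f := f.2
  exact ⟨μ.map fun x => x + z, by rw [Phi_map_add, hμ]⟩

/-- Translation as a linear map of `A₀`. -/
noncomputable def translatePhiAux (z : X) : PhiRange X →ₗ[ℝ] PhiRange X :=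
  ((translateBCF z).toLinearEquiv.toLinearMap ∘ₗ PhiRange.toBCF X).codRestrict
    (LinearMap.range (Phi X)) (translateBCF_mem_range z)

lemma toBCF_translatePhiAux (z : X) (f : PhiRange X) :
    PhiRange.toBCF X (translatePhiAux z f) = translateBCF z (PhiRange.toBCF X f) := rfl

lemma translatePhiAux_translatePhiAux (z : X) (f : PhiRange X) :
    translatePhiAux (-z) (translatePhiAux z f) = f := by
  refine toBCF_injective ?_
  ext x
  simp [toBCF_translatePhiAux, translateBCF_apply]

lemma norm_translatePhiAux_le (z : X) (f : PhiRange X) : ‖translatePhiAux z f‖ ≤ ‖f‖ := by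
  refine le_of_forall_gt_imp_ge_of_dense fun a ha => ?_
  obtain ⟨b, hb, hba, g, ⟨μ, hμ, h⟩, rfl⟩ := exists_lt_of_gauge_lt absorbent_PhiBall ha
  have hmem : translatePhiAux z g ∈ PhiBall X :=
    ⟨μ.map fun x => x + z,
      (measureNorm_map_le μ (continuous_add_const z).measurable).trans hμ,
      by rw [Phi_map_add, h, toBCF_translatePhiAux]⟩
  have hsmul : translatePhiAux z (b • g) ∈ (fun x => b • x) '' PhiBall X :=
    ⟨_, hmem, ((translatePhiAux z).map_smul b g).symm⟩
  exact (gauge_le_of_mem hb.le hsmul).trans hba.le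

/-- Translation as an isometry of `A₀`. -/
noncomputable def translatePhi (z : X) : PhiRange X ≃ₗᵢ[ℝ] PhiRange X where
  toLinearEquiv := LinearEquiv.ofLinearMap (translatePhiAux z) (translatePhiAux (-z))
    (LinearMap.ext fun f => by simpa using translatePhiAux_translatePhiAux (-z) f)
    (LinearMap.ext fun f => translatePhiAux_translatePhiAux z f)
  norm_map' f := by
    refine le_antisymm (norm_translatePhiAux_le z f) ?_
    have := norm_translatePhiAux_le (-z) (translatePhiAux z f)
    rwa [translatePhiAux_translatePhiAux] at this

lemma incl_translatePhi (z : X) (f : PhiRange X) :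
    PhiRange.incl X (translatePhi z f) = translateBCF z (PhiRange.incl X f) := rfl

/-- The kernel is 1-Lipschitz; bounding each Jordan part by the total mass gives the 2. -/
lemma norm_translateBCF_Phi_sub_le (μ : SignedMeasure X) (z : X) :
    ‖translateBCF z (Phi X μ) - Phi X μ‖ ≤ ‖z‖ * (2 * measureNorm μ) := by
  have key : ∀ (P : Measure X) [IsFiniteMeasure P], P.real univ ≤ measureNorm μ →
      ‖translateBCF z (Phi X P.toSignedMeasure) - Phi X P.toSignedMeasure‖ ≤
        ‖z‖ * measureNorm μ := by
    intro P _ hP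
    refine (BoundedContinuousFunction.norm_le
      (mul_nonneg (norm_nonneg z) ENNReal.toReal_nonneg)).2 fun y => ?_
    rw [BoundedContinuousFunction.sub_apply, translateBCF_apply, Phi_toSignedMeasure_apply,
      Phi_toSignedMeasure_apply, ← integral_sub (integrable_exp_neg_norm_sub P _)
      (integrable_exp_neg_norm_sub P _)]
    refine (norm_integral_le_of_norm_le_const (C := ‖z‖) (ae_of_all _ fun x => ?_)).trans
      (mul_le_mul_of_nonneg_left hP (norm_nonneg z))
    refine (abs_exp_neg_norm_sub_le _ _).trans_eq ?_
    congr 1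
    abel
  have htv : μ.toJordanDecomposition.posPart.real univ +
      μ.toJordanDecomposition.negPart.real univ = measureNorm μ := by
    rw [measureNorm, SignedMeasure.totalVariation, measureReal_add_apply]
  have h1 := key μ.toJordanDecomposition.posPart (by
    linarith [measureReal_nonneg (μ := μ.toJordanDecomposition.negPart) (s := univ)])
  have h2 := key μ.toJordanDecomposition.negPart (by
    linarith [measureReal_nonneg (μ := μ.toJordanDecomposition.posPart) (s := univ)])
  have h3 : translateBCF z (Phi X μ) - Phi X μ =
      (translateBCF z (Phi X μ.toJordanDecomposition.posPart.toSignedMeasure) -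
        Phi X μ.toJordanDecomposition.posPart.toSignedMeasure) -
      (translateBCF z (Phi X μ.toJordanDecomposition.negPart.toSignedMeasure) -
        Phi X μ.toJordanDecomposition.negPart.toSignedMeasure) := by
    conv_lhs => rw [eq_posPart_sub_negPart μ, map_sub, map_sub]
    abel
  rw [h3]
  refine (norm_sub_le _ _).trans ?_
  linarith

end Phi

/-! ### Strong continuity of translations -/

section InterpolationOfPhi

variable {X : Type u} [NormedAddCommGroup X] [MeasurableSpace X] [BorelSpace X]
  {R : Type*} [NormedAddCommGroup R] [NormedSpace ℝ R] {θ p : ℝ} {j : R →ₗ[ℝ] (X →ᵇ ℝ)}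

/-- Elements of R are uniform limits of potentials, which are Lipschitz. The small remainder `y`
counts twice, as translation preserves its norm. -/
lemma tendsto_norm_translateBCF_sub (h : IsInterpolationSpace (PhiRange.incl X) θ p j)
    (hθ₀ : 0 < θ) (hθ₁ : θ < 1) (hp : 1 < p) (r : R) :
    Tendsto (fun z => ‖translateBCF z (j r) - j r‖) (𝓝 0) (𝓝 0) := by
  refine Metric.tendsto_nhds.2 fun ε hε => ?_
  obtain ⟨C, -, hdec⟩ := h.exists_decomp_norm_le hθ₀ hθ₁ hp ‖r‖ (show 0 < ε / 4 by positivity)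
  obtain ⟨f, y, hfy, -, hy⟩ := hdec r le_rfl
  obtain ⟨μ, hμ⟩ : ∃ μ, Phi X μ = PhiRange.incl X f := f.2
  have hlim : Tendsto (fun z : X => ‖z‖ * (2 * measureNorm μ)) (𝓝 0) (𝓝 0) := by
    simpa using (tendsto_norm_zero (E := X)).mul_const (2 * measureNorm μ)
  filter_upwards [hlim.eventually_lt_const (show 0 < ε / 4 by positivity)] with z hz
  rw [Real.dist_eq, sub_zero, abs_norm, hfy, ← hμ, map_add]
  have h1 := norm_translateBCF_Phi_sub_le μ z
  have h2 := norm_sub_le (translateBCF z y) y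
  rw [LinearIsometryEquiv.norm_map] at h2
  have h3 := norm_add_le (translateBCF z (Phi X μ) - Phi X μ) (translateBCF z y - y)
  rw [show translateBCF z (Phi X μ) + translateBCF z y - (Phi X μ + y) =
    (translateBCF z (Phi X μ) - Phi X μ) + (translateBCF z y - y) by abel]
  linarith

/-- Translations act continuously on the interpolation space. -/
lemma tendsto_translation_sub (h : IsInterpolationSpace (PhiRange.incl X) θ p j)
    (hθ₀ : 0 < θ) (hθ₁ : θ < 1) (hp : 1 < p) {T : X → (R ≃ₗᵢ[ℝ] R)}
    (hT : ∀ z r, j (T z r) = translateBCF z (j r)) (r : R) :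
    Tendsto (fun z => ‖T z r - r‖) (𝓝 0) (𝓝 0) := by
  have hdisc := tendsto_interpDisc_of_dominated (ι := PhiRange.incl X) (θ := θ) hp
    (tendsto_norm_translateBCF_sub h hθ₀ hθ₁ hp r) (h.interpDisc_ne_top hθ₀ hθ₁ hp r)
    -- Translation does not increase the K-functional, so that of the difference is dominated by
    -- twice that of `j r`.
    fun z n => by
      refine (map_sub_le_add _ _ _).trans ?_
      linarith [IsInterpolationSpace.interpK_map_equiv_le (ι := PhiRange.incl X) (θ := θ)
        (translatePhi z) (translateBCF z) (incl_translatePhi z) n (j r)]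
  have hreal := ((ENNReal.tendsto_toReal ENNReal.zero_ne_top).comp hdisc).const_mul
    (2 * Real.exp 1)
  rw [ENNReal.toReal_zero, mul_zero] at hreal
  refine squeeze_zero (fun _ => norm_nonneg _) (fun z => ?_) hreal
  have := h.norm_le hθ₀ hθ₁ hp (T z r - r)
  rwa [map_sub, hT] at this

end InterpolationOfPhi

/-! ### Elements of A₀ in R, and consequences of reflexivity -/

section Membership

lemma memLp_exp_smul_const {E : Type*} [NormedAddCommGroup E] [NormedSpace ℝ E] {c p : ℝ}
    (hp : 0 < p) {s : Set ℝ} (hs : IntegrableOn (fun t : ℝ => Real.exp (c * p * t)) s) (v : E) :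
    MemLp (fun t : ℝ => Real.exp (c * t) • v) (ENNReal.ofReal p) (volume.restrict s) := by
  have hm : AEStronglyMeasurable (fun t : ℝ => Real.exp (c * t) • v) (volume.restrict s) :=
    (by fun_prop : Continuous fun t : ℝ => Real.exp (c * t) • v).aestronglyMeasurable
  rw [← integrable_norm_rpow_iff hm (by simpa using hp) ENNReal.ofReal_ne_top,
    ENNReal.toReal_ofReal hp.le]
  refine (Integrable.mul_const hs (‖v‖ ^ p)).congr (ae_of_all _ fun t => ?_)
  simp only [norm_smul, Real.norm_eq_abs, Real.abs_exp]
  rw [Real.mul_rpow (Real.exp_pos _).le (norm_nonneg v), ← Real.exp_mul]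
  ring_nf

lemma map_mem_interpSet {A₀ A₁ : Type*} [NormedAddCommGroup A₀] [NormedSpace ℝ A₀]
    [NormedAddCommGroup A₁] [NormedSpace ℝ A₁] (ι : A₀ →L[ℝ] A₁) {θ p : ℝ}
    (hθ₀ : 0 < θ) (hθ₁ : θ < 1) (hp : 0 < p) (a : A₀) : ι a ∈ interpSet ι θ p := by
  -- Each component is used on the half-line where its weight decays.
  refine ⟨(Iic 0).indicator fun _ => a, (Iic 0)ᶜ.indicator fun _ => ι a, fun t => ?_, ?_, ?_⟩
  · by_cases ht : t ∈ Iic (0 : ℝ)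
    · rw [indicator_of_mem ht, indicator_of_notMem (notMem_compl_iff.2 ht), add_zero]
    · rw [indicator_of_notMem ht, indicator_of_mem (mem_compl ht), map_zero, zero_add]
  · have h := (memLp_indicator_iff_restrict measurableSet_Iic).2
      (memLp_exp_smul_const hp (integrableOn_exp_mul_Iic (mul_pos hθ₀ hp) 0) a)
    simpa only [indicator_smul] using h
  · have h := (memLp_indicator_iff_restrict measurableSet_Ioi).2
      (memLp_exp_smul_const hp (integrableOn_exp_mul_Ioi
        (mul_neg_of_neg_of_pos (by linarith : -(1 - θ) < 0) hp) 0) (ι a))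
    rw [compl_Iic]
    simpa only [indicator_smul] using h

end Membership

/-- A reflexive space is isometric to its bidual, and dual spaces are complete. -/
lemma IsReflexiveSpace.completeSpace {R : Type*} [NormedAddCommGroup R] [NormedSpace ℝ R]
    (h : IsReflexiveSpace R) : CompleteSpace R := by
  let e := LinearIsometryEquiv.ofSurjective (NormedSpace.inclusionInDoubleDualLi ℝ (E := R)) h
  exact (completeSpace_congr (e := e.toEquiv) e.isometry.isUniformEmbedding).2 inferInstance

/-- A reflexive space is separable if countably many functionals separate its points. -/
lemma IsReflexiveSpace.separableSpace {R : Type*} [NormedAddCommGroup R] [NormedSpace ℝ R]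
    (h : IsReflexiveSpace R) (ψ : ℕ → StrongDual ℝ R) (hψ : ∀ r, (∀ n, ψ n r = 0) → r = 0) :
    TopologicalSpace.SeparableSpace R := by
  have : TopologicalSpace.SeparableSpace (StrongDual ℝ R) := by
    refine separableSpace_of_forall_dual_eq_zero ψ fun Ξ hΞ => ?_
    obtain ⟨r, rfl⟩ := h Ξ
    rw [hψ r hΞ, map_zero]
  exact separableSpace_of_separableSpace_dual

/-! ### Closed embeddings in the strong operator topology -/

section StrongOperatorTopology

variable {R : Type*} [NormedAddCommGroup R] [NormedSpace ℝ R]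

lemma continuous_strongOperatorTopology_apply (r : R) :
    Continuous fun S : R ≃ₗᵢ[ℝ] R => S r :=
  (continuous_apply r).comp continuous_induced_dom

instance t2Space_strongOperatorTopology : T2Space (R ≃ₗᵢ[ℝ] R) :=
  T2Space.of_injective_continuous (f := fun (S : R ≃ₗᵢ[ℝ] R) (r : R) => S r)
    (fun _ _ h => LinearIsometryEquiv.ext (congrFun h)) continuous_induced_dom

/-- A strongly continuous family of isometries, one of whose orbit maps is uniformly inducing,
embeds a complete space as a closed set. -/
lemma isEmbedding_isClosed_range_of_isUniformInducing {X : Type*} [UniformSpace X] [T0Space X]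
    [CompleteSpace X] {T : X → (R ≃ₗᵢ[ℝ] R)} (hT : Continuous T) {r₀ : R}
    (ho : IsUniformInducing fun z => T z r₀) : IsEmbedding T ∧ IsClosed (range T) := by
  have hind : IsInducing T :=
    .of_comp hT (continuous_strongOperatorTopology_apply r₀) ho.isInducing
  refine ⟨hind.isEmbedding, isClosed_of_closure_subset fun S hS => ?_⟩
  have hne : (comap T (𝓝 S)).NeBot :=
    comap_neBot_iff_frequently.2 (mem_closure_iff_frequently.1 hS)
  have hlim : Tendsto (fun z => T z r₀) (comap T (𝓝 S)) (𝓝 (S r₀)) :=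
    ((continuous_strongOperatorTopology_apply r₀).tendsto S).comp tendsto_comap
  -- Strong convergence of translates to `S` makes the orbit Cauchy, hence the parameters Cauchy in
  -- X; their limit `z` satisfies `T z = S`.
  obtain ⟨z, hz⟩ := CompleteSpace.complete (ho.cauchy_map_iff.1 hlim.cauchy_map)
  exact ⟨z, tendsto_nhds_unique ((hT.tendsto z).mono_left hz) tendsto_comap⟩

end StrongOperatorTopology

/-! ### The orbit of e^{-‖x‖} and the main theorem -/

section Translations

variable {X : Type u} [NormedAddCommGroup X] [MeasurableSpace X] [BorelSpace X]
  {R : Type*} [NormedAddCommGroup R] [NormedSpace ℝ R] {θ p : ℝ} {j : R →ₗ[ℝ] (X →ᵇ ℝ)}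

/-- This function is the potential of the Dirac mass at 0. -/
lemma IsInterpolationSpace.exists_eq_exp_neg_norm
    (h : IsInterpolationSpace (PhiRange.incl X) θ p j) (hθ₀ : 0 < θ) (hθ₁ : θ < 1) (hp : 1 < p) :
    ∃ r, ∀ x, j r x = Real.exp (-‖x‖) := by
  have hmem := map_mem_interpSet (PhiRange.incl X) hθ₀ hθ₁ (zero_lt_one.trans hp)
    ⟨Phi X (Measure.dirac (0 : X)).toSignedMeasure, LinearMap.mem_range_self _ _⟩
  rw [← h.range_eq] at hmem
  obtain ⟨r, hr⟩ := hmem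
  refine ⟨r, fun x => ?_⟩
  rw [hr]
  refine (Phi_toSignedMeasure_apply _ x).trans ?_
  rw [integral_dirac, zero_sub, norm_neg]

/-- A point of `X` is controlled by the displacement of `exp (-‖x‖)` under its translation. -/
lemma one_sub_exp_neg_norm_le {X R : Type*} [NormedAddCommGroup X] [NormedAddCommGroup R]
    [NormedSpace ℝ R] {J : R →L[ℝ] (X →ᵇ ℝ)} {r₀ : R}
    (hr₀ : ∀ x, J r₀ x = Real.exp (-‖x‖)) {S : R} {z : X} (hS : J S = translateBCF z (J r₀)) :
    1 - Real.exp (-‖z‖) ≤ ‖J‖ * ‖S - r₀‖ := by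
  refine le_trans ?_ (J.le_opNorm (S - r₀))
  refine le_trans ?_ ((J (S - r₀)).norm_coe_le_norm z)
  rw [map_sub, BoundedContinuousFunction.sub_apply, hS, translateBCF_apply, hr₀, hr₀, sub_self,
    norm_zero, neg_zero, Real.exp_zero]
  exact le_abs_self _

/-- By the group law and isometry, orbit distances depend only on x - y. Small displacement in X
gives small orbit distance by `hlim`; the converse is `one_sub_exp_neg_norm_le`. -/
lemma isUniformInducing_orbit {X R : Type*} [NormedAddCommGroup X] [NormedAddCommGroup R]
    [NormedSpace ℝ R] {T : X → (R ≃ₗᵢ[ℝ] R)}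
    (hadd : ∀ x y r, T (x + y) r = T x (T y r)) {J : R →L[ℝ] (X →ᵇ ℝ)} {r₀ : R}
    (hr₀ : ∀ x, J r₀ x = Real.exp (-‖x‖))
    (hT : ∀ z r, J (T z r) = translateBCF z (J r))
    (hlim : Tendsto (fun z => ‖T z r₀ - r₀‖) (𝓝 0) (𝓝 0)) :
    IsUniformInducing fun z => T z r₀ := by
  have hdist : ∀ x y, dist (T x r₀) (T y r₀) = ‖T (x - y) r₀ - r₀‖ := fun x y => by
    rw [dist_eq_norm, ← (T y).norm_map (T (x - y) r₀ - r₀), map_sub, ← hadd, add_sub_cancel]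
  refine Metric.isUniformInducing_iff.2 ⟨Metric.uniformContinuous_iff.2 fun ε hε => ?_,
    fun δ hδ => ?_⟩
  · obtain ⟨δ, hδ, hball⟩ := Metric.eventually_nhds_iff.1 (hlim.eventually_lt_const hε)
    refine ⟨δ, hδ, fun {x y} hxy => ?_⟩
    rw [hdist]
    exact hball (by rwa [dist_zero_right, ← dist_eq_norm])
  · have hexp : 0 < 1 - Real.exp (-δ) := by
      rw [sub_pos, Real.exp_lt_one_iff]
      linarith
    refine ⟨(1 - Real.exp (-δ)) / (‖J‖ + 1), by positivity, fun {x y} hxy => ?_⟩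
    rw [hdist, lt_div_iff₀ (by positivity)] at hxy
    have h1 := one_sub_exp_neg_norm_le hr₀ (hT (x - y) r₀)
    have h2 : Real.exp (-δ) < Real.exp (-‖x - y‖) := by
      nlinarith [norm_nonneg (T (x - y) r₀ - r₀)]
    rw [dist_eq_norm]
    linarith [Real.exp_lt_exp.1 h2]

end Translations

theorem theorem1 {X : Type u} [NormedAddCommGroup X] [NormedSpace ℝ X] [CompleteSpace X]
    [TopologicalSpace.SeparableSpace X] [MeasurableSpace X] [BorelSpace X] (hX : IsStable X)
    (θ p : ℝ) (hθ₀ : 0 < θ) (hθ₁ : θ < 1) (hp : 1 < p) :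
    ∃ (R : Type u) (_ : NormedAddCommGroup R) (_ : NormedSpace ℝ R) (j : R →ₗ[ℝ] (X →ᵇ ℝ)),
      IsInterpolationSpace (PhiRange.incl X) θ p j ∧
      CompleteSpace R ∧ TopologicalSpace.SeparableSpace R ∧ IsReflexiveSpace R ∧
      ∃ (T : X → (R ≃ₗᵢ[ℝ] R)) (G : Subgroup (R ≃ₗᵢ[ℝ] R)),
        (∀ (z : X) (r : R) (x : X), j (T z r) x = j r (x - z)) ∧
        (∀ (x y : X) (r : R), T (x + y) r = T x (T y r)) ∧
        (∀ x : X, (T x)⁻¹ = T (-x)) ∧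
        range T = (G : Set (R ≃ₗᵢ[ℝ] R)) ∧
        IsClosed (G : Set (R ≃ₗᵢ[ℝ] R)) ∧
        IsEmbedding T := by
  obtain ⟨R, _, _, j, h⟩ := exists_isInterpolationSpace (PhiRange.incl X) hθ₀ hθ₁ hp
  have hrefl : IsReflexiveSpace R :=
    h.isReflexiveSpace hθ₀ hθ₁ hp (isRelWeaklyCompact_incl hX)
  obtain ⟨J, hJ⟩ := h.exists_continuousLinearMap hθ₀ hθ₁ hp
  have hsep : TopologicalSpace.SeparableSpace R := by
    -- Evaluations at a dense sequence separate continuous functions.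
    refine hrefl.separableSpace (fun n =>
      (BoundedContinuousFunction.evalCLM ℝ (TopologicalSpace.denseSeq X n)).comp J) fun r hr => ?_
    refine h.injective ((?_ : j r = 0).trans (map_zero j).symm)
    refine DFunLike.coe_injective ((TopologicalSpace.denseRange_denseSeq X).equalizer
      (j r).continuous continuous_const (funext fun n => ?_))
    rw [← hJ]
    exact hr n
  choose T hT using fun z => h.exists_isometryEquiv (translatePhi z) (translateBCF z)
    (incl_translatePhi z)
  have hadd : ∀ x y r, T (x + y) r = T x (T y r) := fun x y r => h.injective <| by
    ext w
    rw [hT, hT, hT, translateBCF_apply, translateBCF_apply, translateBCF_apply, sub_sub]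
  have hzero : T 0 = 1 := LinearIsometryEquiv.ext fun r => h.injective <| by
    ext w
    rw [hT, translateBCF_apply, sub_zero]
    rfl
  have hmul : ∀ x y, T (x + y) = T x * T y := fun x y => LinearIsometryEquiv.ext (hadd x y)
  have hinv : ∀ x, (T x)⁻¹ = T (-x) := fun x =>
    inv_eq_of_mul_eq_one_right (by rw [← hmul, add_neg_cancel, hzero])
  have hlim := tendsto_translation_sub h hθ₀ hθ₁ hp hT
  have hcont : Continuous T := by
    refine continuous_induced_rng.2 (continuous_pi fun r => continuous_iff_continuousAt.2
      fun z => tendsto_iff_norm_sub_tendsto_zero.2 ?_)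
    refine ((hlim r).comp (tendsto_sub_nhds_zero_iff.2 (tendsto_id (x := 𝓝 z)))).congr fun w => ?_
    rw [Function.comp_apply, id, ← (T z).norm_map, map_sub, ← hadd, add_sub_cancel]
    rfl
  obtain ⟨r₀, hr₀⟩ := h.exists_eq_exp_neg_norm hθ₀ hθ₁ hp
  obtain ⟨hemb, hclosed⟩ := isEmbedding_isClosed_range_of_isUniformInducing hcont
    (isUniformInducing_orbit hadd (J := J) (r₀ := r₀) (fun x => by rw [hJ, hr₀])
      (fun z r => by rw [hJ, hJ, hT]) (hlim r₀))
  let G : Subgroup (R ≃ₗᵢ[ℝ] R) :=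
    { carrier := range T
      mul_mem' := by
        rintro _ _ ⟨x, rfl⟩ ⟨y, rfl⟩
        exact ⟨x + y, hmul x y⟩
      one_mem' := ⟨0, hzero⟩
      inv_mem' := by
        rintro _ ⟨x, rfl⟩
        exact ⟨-x, (hinv x).symm⟩ }
  refine ⟨R, _, _, j, h, hrefl.completeSpace, hsep, hrefl, T, G, fun z r x => ?_, hadd, hinv, rfl,
    hclosed, hemb⟩
  rw [hT, translateBCF_apply]
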